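/- Three points $A$ (attacker), $D$ (defender), $T$ (target) move in the Euclidean plane with measurable headings $\chi,\psi,\phi\in[-\pi,\pi]$ and speeds $1$, $1$, $\alpha$, where $0\le\alpha<1$: $\dot x_A=\cos\chi,\ \dot y_A=\sin\chi,\ \dot x_D=\cos\psi,\ \dot y_D=\sin\psi,\ \dot x_T=\alpha\cos\phi,\ \dot y_T=\alpha\sin\phi$. A play in which $A$ meets $D$ (before meeting $T$) ends at the first time $t_f$ with $A=D$, at cost $J=\tfrac12|A(t_f)-T(t_f)|^2$. The attacker minimizes $J$, the team of target and defender maximizes it. For a state with $A\ne D$ use the Cartesian frame with origin at the midpoint of $AD$ in which $A=(x_A,0)$, $D=(-x_A,0)$, $T=(x_T,y_T)$ with $x_A>0$ and $y_T\ge0$ (reflecting the second axis if necessary). The escape region $R_e$ consists of the states with $A\neq D$ and $x_T<0$ or $x_T^2<\alpha^2\bigl(x_A^2+\tfrac{y_T^2}{1-\alpha^2}\bigr)$; for $\alpha>0$ this says $x_T\le 0$ or $x_A^2+\frac{y_T^2}{1-\alpha^2}-\frac{x_T^2}{\alpha^2}>0$. (1) Roots. For $x_A>0$, $y_T\ge0$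 and every $x_T$, the quartic equation $$(1-\alpha^2)y^4-2(1-\alpha^2)y_Ty^3+\bigl[(1-\alpha^2)y_T^2+x_A^2-\alpha^2x_T^2\bigr]y^2-2x_A^2y_Ty+x_A^2y_T^2=0$$ has exactly one root $y_1$ in $[0,y_T]$ and at least one root $y_2$ in $[y_T,\infty)$; the latter is the only one in $[y_T,\infty)$ if $y_T>0$, or if $x_T>0$ and the state is in $R_e$. (2) Optimal headings. Let $y=y_1$ if $x_T\le0$ and $y=y_2$ if $x_T>0$. In $R_e$ define state feedback headings, in the frame above, by $$\cos\chi^*=-\frac{x_A}{\sqrt{x_A^2+y^2}},\quad \sin\chi^*=\frac{y}{\sqrt{x_A^2+y^2}},\qquad \cos\psi^*=\frac{x_A}{\sqrt{x_A^2+y^2}},\quad \sin\psi^*=\frac{y}{\sqrt{x_A^2+y^2}},$$ $$\cos\phi^*=\pm\frac{x_T}{\sqrt{x_T^2+(y_T-y)^2}},\quad \sin\phi^*=\pm\frac{y_T-y}{\sqrt{x_T^2+(y_T-y)^2}}\qquad(x_T\ne0),$$ with the sign $+$ if $x_T<0$ and $-$ if $x_T>0$; if $x_T=0$, then $\phi^*=\tilde\varphi+\frac\pi2$,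 where $0<\tilde\varphi\le\frac\pi2$, $\tan\tilde\varphi=\frac{\sqrt{x_A^2+(1-\alpha^2)y_T^2}}{\alpha y_T}$ (and $\tilde\varphi=\frac\pi2$ if $y_T=0$). These headings are optimal in $R_e$: there is a function $V$ on $R_e$ such that for every initial state $s\in R_e$ (a) there is a play from $s$ in which all three players use these laws; it stays in $R_e$ until $A$ meets $D$ in finite time, non-tangentially, and its cost is $V(s)$; (b) if target and defender use their laws (in $R_e$) then, whatever the attacker does, as long as $A$ and $D$ have not met the state stays in $R_e$, the target is not captured, and $V$ at the current state is at least $V(s)$; if $A$ meets $D$, then $J\ge V(s)$, and $J=V(s)$ only if the attacker's heading follows his law at almost all times; (c) if the attacker uses his law then, whatever target and defender do, as long as the state stays in $R_e$, $V$ at the current state is at most $V(s)$; if the state stays in $R_e$ until $A$ meets $D$ and they meet non-tangentially, then $J\le V(s)$, and $J=V(s)$ only if the defender's heading and, for $\alpha>0$, the target's heading follow their laws at almost all times. Here $A$ and $D$ meet non-tangentially at time $t_f$ if $|A(t)-D(t)|\ge\kappa(t_f-t)$ for some $\kappa>0$ and all $t\in[0,t_f]$. -/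

import Mathlib

open MeasureTheory Set

noncomputable section

namespace ATDDG

/-! ### The reduced state space `(xA, xT, yT)`: `A = (xA, 0)`, `D = (-xA, 0)`, `T = (xT, yT)` -/

/-- The quartic polynomial whose real roots are the candidate aimpoints. -/
def quartic (α xA xT yT y : ℝ) : ℝ :=
  (1 - α ^ 2) * y ^ 4 - 2 * (1 - α ^ 2) * yT * y ^ 3
    + ((1 - α ^ 2) * yT ^ 2 + xA ^ 2 - α ^ 2 * xT ^ 2) * y ^ 2
    - 2 * xA ^ 2 * yT * y + xA ^ 2 * yT ^ 2

/-- `y` is the root called `y₁`: it lies between the line `AD` and the height of the target. -/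
def IsY1 (α xA xT yT y : ℝ) : Prop :=
  quartic α xA xT yT y = 0 ∧ 0 ≤ y ∧ y ≤ yT

/-- `y` is the root called `y₂`: it lies above the height of the target. -/
def IsY2 (α xA xT yT y : ℝ) : Prop :=
  quartic α xA xT yT y = 0 ∧ yT ≤ y

/-- The selected aimpoint `(0, y)`: `y₁` if `xT ≤ 0`, `y₂` if `xT > 0`. -/
def IsAimpoint (α xA xT yT y : ℝ) : Prop :=
  (xT ≤ 0 → IsY1 α xA xT yT y) ∧ (0 < xT → IsY2 α xA xT yT y)

/-- The escape condition in reduced coordinates.  For `0 < α` and `0 < xA` this is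
`xT ≤ 0` or `xA ^ 2 + yT ^ 2 / (1 - α ^ 2) - xT ^ 2 / α ^ 2 > 0`, cleared of the
denominator `α ^ 2`; for `α = 0` (a motionless target) it is `xT < 0`. -/
def CanEscape (α xA xT yT : ℝ) : Prop :=
  xT < 0 ∨ xT ^ 2 < α ^ 2 * (xA ^ 2 + yT ^ 2 / (1 - α ^ 2))

/-- The heading of the attacker in the reduced frame. -/
def AttackerHeading (α xA xT yT χ : ℝ) : Prop :=
  ∃ y, IsAimpoint α xA xT yT y ∧
    Real.cos χ = -(xA / √(xA ^ 2 + y ^ 2)) ∧ Real.sin χ = y / √(xA ^ 2 + y ^ 2)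

/-- The heading of the defender in the reduced frame. -/
def DefenderHeading (α xA xT yT ψ : ℝ) : Prop :=
  ∃ y, IsAimpoint α xA xT yT y ∧
    Real.cos ψ = xA / √(xA ^ 2 + y ^ 2) ∧ Real.sin ψ = y / √(xA ^ 2 + y ^ 2)

/-- The heading of the target in the reduced frame.  For `xT = 0` it is `φ' + π / 2`, where
`0 < φ' ≤ π / 2` and `tan φ' = √(xA ^ 2 + (1 - α ^ 2) * yT ^ 2) / (α * yT)`, the value of
the angle being `π / 2` if the denominator vanishes. -/
def TargetHeading (α xA xT yT φ : ℝ) : Prop :=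
  (xT < 0 → ∃ y, IsAimpoint α xA xT yT y ∧
    Real.cos φ = xT / √(xT ^ 2 + (yT - y) ^ 2) ∧
    Real.sin φ = (yT - y) / √(xT ^ 2 + (yT - y) ^ 2)) ∧
  (0 < xT → ∃ y, IsAimpoint α xA xT yT y ∧
    Real.cos φ = -(xT / √(xT ^ 2 + (yT - y) ^ 2)) ∧
    Real.sin φ = -((yT - y) / √(xT ^ 2 + (yT - y) ^ 2))) ∧
  (xT = 0 → ∃ φ' : ℝ, 0 < φ' ∧ φ' ≤ Real.pi / 2 ∧
    (α * yT ≠ 0 → Real.tan φ' = √(xA ^ 2 + (1 - α ^ 2) * yT ^ 2) / (α * yT)) ∧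
    (α * yT = 0 → φ' = Real.pi / 2) ∧
    φ = φ' + Real.pi / 2)

/-! ### The game in the plane, identified with `ℂ` -/

/-- The positions of attacker, defender and target. -/
structure GameState where
  A : ℂ
  D : ℂ
  T : ℂ

namespace GameState

/-- The unit vector pointing from `D` to `A`: first axis of the reduced frame. -/
def axis (s : GameState) : ℂ := (s.A - s.D) / (‖s.A - s.D‖ : ℂ)

/-- The position of `T` relative to the midpoint of `AD`, in coordinates whose first axis
is `s.axis` and whose second axis is `s.axis` turned by `π / 2`. -/
def rel (s : GameState) : ℂ := (s.T - (s.A + s.D) / 2) / s.axis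

/-- The second axis of the reduced frame is reflected, if necessary, so that `yT ≥ 0`. -/
def orient (s : GameState) : ℝ := if s.rel.im < 0 then -1 else 1

def xA (s : GameState) : ℝ := ‖s.A - s.D‖ / 2

def xT (s : GameState) : ℝ := s.rel.re

def yT (s : GameState) : ℝ := s.orient * s.rel.im

/-- The heading `χ` in the plane corresponds to the heading `θ` in the reduced frame of `s`. -/
def Corresponds (s : GameState) (χ θ : ℝ) : Prop :=
  Complex.exp (χ * Complex.I) = s.axis * Complex.exp ((s.orient * θ : ℝ) * Complex.I)

end GameState

/-- The region of the full state space in which the target can escape. -/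
def escapeRegion (α : ℝ) : Set GameState :=
  {s | s.A ≠ s.D ∧ CanEscape α s.xA s.xT s.yT}

/-- The state feedback law of the attacker, in the plane. -/
def AttackerLaw (α : ℝ) (s : GameState) (χ : ℝ) : Prop :=
  ∃ θ, AttackerHeading α s.xA s.xT s.yT θ ∧ s.Corresponds χ θ

/-- The state feedback law of the defender, in the plane. -/
def DefenderLaw (α : ℝ) (s : GameState) (ψ : ℝ) : Prop :=
  ∃ θ, DefenderHeading α s.xA s.xT s.yT θ ∧ s.Corresponds ψ θ

/-- The state feedback law of the target, in the plane. -/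
def TargetLaw (α : ℝ) (s : GameState) (φ : ℝ) : Prop :=
  ∃ θ, TargetHeading α s.xA s.xT s.yT θ ∧ s.Corresponds φ θ

/-- A play: measurable headings with values in `[-π, π]` and the trajectory that they
generate, with speeds `1` for `A` and `D` and `α` for `T`. -/
structure Play (α : ℝ) where
  χ : ℝ → ℝ
  ψ : ℝ → ℝ
  φ : ℝ → ℝ
  state : ℝ → GameState
  measurable_χ : Measurable χ
  measurable_ψ : Measurable ψ
  measurable_φ : Measurable φ
  χ_mem : ∀ t, χ t ∈ Icc (-Real.pi) Real.pi
  ψ_mem : ∀ t, ψ t ∈ Icc (-Real.pi) Real.pi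
  φ_mem : ∀ t, φ t ∈ Icc (-Real.pi) Real.pi
  motion_A : ∀ t, 0 ≤ t →
    (state t).A = (state 0).A + ∫ s in (0 : ℝ)..t, Complex.exp (χ s * Complex.I)
  motion_D : ∀ t, 0 ≤ t →
    (state t).D = (state 0).D + ∫ s in (0 : ℝ)..t, Complex.exp (ψ s * Complex.I)
  motion_T : ∀ t, 0 ≤ t →
    (state t).T = (state 0).T + ∫ s in (0 : ℝ)..t, (α : ℂ) * Complex.exp (φ s * Complex.I)

namespace Play

variable {α : ℝ}

/-- Before time `τ` the attacker is neither intercepted nor captures the target. -/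
def Running (p : Play α) (τ : ℝ) : Prop :=
  ∀ t ∈ Ico 0 τ, (p.state t).A ≠ (p.state t).D ∧ (p.state t).A ≠ (p.state t).T

/-- The cost at time `τ`: half the squared distance of attacker and target. -/
def cost (p : Play α) (τ : ℝ) : ℝ := ‖(p.state τ).A - (p.state τ).T‖ ^ 2 / 2

/-- The distance of `A` and `D` does not vanish at time `τ` to higher than first order. -/
def NonTangential (p : Play α) (τ : ℝ) : Prop :=
  ∃ κ > 0, ∀ t ∈ Icc 0 τ, κ * (τ - t) ≤ ‖(p.state t).A - (p.state t).D‖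

/-- The attacker uses his feedback law up to time `τ`, wherever the target can escape. -/
def AttackerFollows (p : Play α) (τ : ℝ) : Prop :=
  ∀ t ∈ Ico 0 τ, p.state t ∈ escapeRegion α → AttackerLaw α (p.state t) (p.χ t)

/-- Target and defender use their feedback laws up to time `τ`, wherever the target can
escape. -/
def TeamFollows (p : Play α) (τ : ℝ) : Prop :=
  ∀ t ∈ Ico 0 τ, p.state t ∈ escapeRegion α →
    DefenderLaw α (p.state t) (p.ψ t) ∧ TargetLaw α (p.state t) (p.φ t)

end Play

end ATDDG

end

/-!
# Saddle point of the attacker–target–defender game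

The escape region has coordinates in which everything is explicit.  Let `P` be the aimpoint, `τ`
the time that `A` and `D` need to reach it, `c` and `q` cosine and sine of the angle under which
they see it (`c ^ 2 + q ^ 2 = 1`), and `κ > 0` with `κ ^ 2 + α ^ 2 * q ^ 2 = 1`.  The quartic says
that the line from `P` to `T` makes the refracted angle, with sine `α * q`, so that `T = P + σ u`
for the unit vector `u` with coordinates `(-κ, α * q)`; the sign of `σ` is the one of `-xT`, which
merges the cases `xT < 0`, `xT = 0`, `xT > 0` (`Aim`, `exists_aim`).  The three laws
prescribe the directions from `A` and `D` to `P` and the direction `u` (`Aim.attackerLaw_iff`,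
`Aim.defenderLaw_iff`, `Aim.targetLaw_iff`).  If all players follow them, then they run on straight
lines, `P` does not move, and the final distance of `A` and `T` is `v = α * τ + σ`
(`Aim.exists_optimal_play`).

The function `v` is on the escape region the maximum over `q` in `[-1, 1]` of
`α * √(1 - q ^ 2) * xA + α * q * yT - √(1 - α ^ 2 * q ^ 2) * xT` (`Aim.payoff_le_of_mem`).  This
makes it locally Lipschitz, hence absolutely continuous along plays, and its derivative is found by
the envelope theorem, without differentiating the root of the quartic (`Aim.hasDerivAt_value`): if
`A`, `D`, `T` move in the directions `x`, `y`, `z`, and `e`, `f` are the directions from `A` and `D`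
to `P`, then
`v' = -α (1 - u·z) + (κ + α c) / (2 c) (1 - e·x) - (κ - α c) / (2 c) (1 - f·y)`.
Since `κ > α c`, the value does not decrease if target and defender follow their laws, does not
increase if the attacker follows his, and is constant only if the opponents follow their laws
at almost all times, too; only the heading of the target is immaterial if `α = 0`.
The escape region is the set where `A ≠ D` and the maximum is positive, so in the first case the
state cannot leave it.

It remains to compare `v` with `|A - T|` when `A` meets `D`.  Always `v ≤ |A - T|`, which is what
target and defender need.  Conversely `|A - T| ≤ v + 2 τ`, so the attacker needs that `τ` comes
close to `0`.  Otherwise the attacker would in the end run almost orthogonally to `AD`, a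
non-tangential meeting would need a defender who deviates from his law by a definite amount on
average, and by the factor `1 / c` in `v'` the value would decrease logarithmically beyond all
bounds (`Play.not_forall_le_time_to_go`).
-/

noncomputable section

namespace ATDDG

/-! ### Roots of the quartic -/

theorem quartic_eq_sub (α xA xT yT y : ℝ) : quartic α xA xT yT y =
    (y - yT) ^ 2 * ((1 - α ^ 2) * y ^ 2 + xA ^ 2) - α ^ 2 * xT ^ 2 * y ^ 2 := by
  unfold quartic; ring

/-- The quartic is the squared form of the stationarity condition
`α * y / √(xA ^ 2 + y ^ 2) = ± (yT - y) / √(xT ^ 2 + (yT - y) ^ 2)`. -/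
theorem quartic_eq_sub' (α xA xT yT y : ℝ) : quartic α xA xT yT y =
    (y - yT) ^ 2 * (xA ^ 2 + y ^ 2) - α ^ 2 * y ^ 2 * (xT ^ 2 + (yT - y) ^ 2) := by
  unfold quartic; ring

theorem continuous_quartic (α xA xT yT : ℝ) : Continuous (quartic α xA xT yT) := by
  unfold quartic; fun_prop

theorem quartic_target_nonpos (α xA xT yT : ℝ) : quartic α xA xT yT yT ≤ 0 := by
  rw [quartic_eq_sub]
  have : 0 ≤ α ^ 2 * xT ^ 2 * yT ^ 2 := by positivity
  linarith [sub_self yT, show (yT - yT) ^ 2 * ((1 - α ^ 2) * yT ^ 2 + xA ^ 2) = 0 by ring]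

section Roots

variable {α xA xT yT : ℝ}

theorem exists_isY1 (hy : 0 ≤ yT) : ∃ y, IsY1 α xA xT yT y := by
  have h0 : 0 ≤ quartic α xA xT yT 0 := by
    rw [quartic_eq_sub]
    have : 0 ≤ yT ^ 2 * xA ^ 2 := by positivity
    linarith
  obtain ⟨y, hy', h⟩ := intermediate_value_Icc' hy
    (continuous_quartic α xA xT yT).continuousOn ⟨quartic_target_nonpos α xA xT yT, h0⟩
  exact ⟨y, h, hy'.1, hy'.2⟩

theorem exists_isY2 (hα0 : 0 ≤ α) (hα1 : α < 1) : ∃ y, IsY2 α xA xT yT y := by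
  have hα : 0 < 1 - α ^ 2 := by nlinarith
  -- at `yT + z` the leading term alone outweighs the only negative one
  set z := α * |xT| / √(1 - α ^ 2) with hz
  have hz0 : 0 ≤ z := by positivity
  have hz2 : (1 - α ^ 2) * z ^ 2 = α ^ 2 * xT ^ 2 := by
    rw [hz, div_pow, mul_pow, sq_abs, Real.sq_sqrt hα.le]
    field_simp
  have h1 : 0 ≤ quartic α xA xT yT (yT + z) := by
    have : quartic α xA xT yT (yT + z) = z ^ 2 * xA ^ 2 +
        ((1 - α ^ 2) * z ^ 2 - α ^ 2 * xT ^ 2) * (yT + z) ^ 2 := by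
      rw [quartic_eq_sub]; ring
    rw [this, hz2]
    nlinarith [mul_nonneg (sq_nonneg z) (sq_nonneg xA)]
  obtain ⟨y, hy', h⟩ := intermediate_value_Icc (show yT ≤ yT + z by linarith)
    (continuous_quartic α xA xT yT).continuousOn ⟨quartic_target_nonpos α xA xT yT, h1⟩
  exact ⟨y, h, hy'.1⟩

/-- Both uniqueness statements compare two positive roots `y`, `y'` through the function
`(1 - α ^ 2) * (y - yT) ^ 2 + xA ^ 2 * (1 - yT / y) ^ 2`, which takes the value
`α ^ 2 * xT ^ 2` at each of them; here it is cleared of denominators. -/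
theorem quartic_cross {y y' : ℝ} (h : quartic α xA xT yT y = 0)
    (h' : quartic α xA xT yT y' = 0) :
    (1 - α ^ 2) * (y * y') ^ 2 * (y - yT) ^ 2 + xA ^ 2 * ((y - yT) * y') ^ 2 =
    (1 - α ^ 2) * (y * y') ^ 2 * (y' - yT) ^ 2 + xA ^ 2 * ((y' - yT) * y) ^ 2 := by
  rw [quartic_eq_sub] at h h'
  linear_combination y' ^ 2 * h - y ^ 2 * h'

theorem IsY1.le (hα0 : 0 ≤ α) (hα1 : α < 1) (hA : 0 < xA) {y y' : ℝ}
    (h : IsY1 α xA xT yT y) (h' : IsY1 α xA xT yT y') : y' ≤ y := by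
  by_contra! hlt
  have hα : 0 < 1 - α ^ 2 := by nlinarith
  obtain ⟨e, y0, y1⟩ := h
  obtain ⟨e', -, y1'⟩ := h'
  have hy : 0 < y := by
    rcases y0.lt_or_eq with h | h
    · exact h
    · rw [quartic_eq_sub, ← h] at e
      have : 0 < yT := by linarith
      have : 0 < yT ^ 2 * xA ^ 2 := by positivity
      linarith
  have key := quartic_cross e e'
  have h1 : (y' - yT) ^ 2 < (y - yT) ^ 2 := by nlinarith
  have h2 : ((y' - yT) * y) ^ 2 < ((y - yT) * y') ^ 2 := by
    rw [sq_lt_sq, abs_mul, abs_mul, abs_of_pos hy, abs_of_pos (hy.trans hlt),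
      abs_of_nonpos (by linarith), abs_of_nonpos (by linarith)]
    nlinarith
  have : (1 - α ^ 2) * (y * y') ^ 2 * (y' - yT) ^ 2 ≤ (1 - α ^ 2) * (y * y') ^ 2 * (y - yT) ^ 2 :=
    mul_le_mul_of_nonneg_left h1.le (by positivity)
  have : xA ^ 2 * ((y' - yT) * y) ^ 2 < xA ^ 2 * ((y - yT) * y') ^ 2 :=
    mul_lt_mul_of_pos_left h2 (by positivity)
  linarith

theorem IsY1.unique (hα0 : 0 ≤ α) (hα1 : α < 1) (hA : 0 < xA) {y y' : ℝ}
    (h : IsY1 α xA xT yT y) (h' : IsY1 α xA xT yT y') : y = y' :=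
  le_antisymm (h'.le hα0 hα1 hA h) (h.le hα0 hα1 hA h')

theorem IsY2.le (hα0 : 0 ≤ α) (hα1 : α < 1) (hA : 0 < xA) (hy : 0 < yT) {y y' : ℝ}
    (h : IsY2 α xA xT yT y) (h' : IsY2 α xA xT yT y') : y' ≤ y := by
  by_contra! hlt
  have hα : 0 < 1 - α ^ 2 := by nlinarith
  obtain ⟨e, y1⟩ := h
  obtain ⟨e', y1'⟩ := h'
  have hy : 0 < y := by linarith
  have key := quartic_cross e e'
  have h1 : (y - yT) ^ 2 < (y' - yT) ^ 2 := by nlinarith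
  have h2 : ((y - yT) * y') ^ 2 < ((y' - yT) * y) ^ 2 := by
    rw [sq_lt_sq, abs_mul, abs_mul, abs_of_pos hy, abs_of_pos (hy.trans hlt),
      abs_of_nonneg (by linarith), abs_of_nonneg (by linarith)]
    nlinarith
  have : (1 - α ^ 2) * (y * y') ^ 2 * (y - yT) ^ 2 ≤ (1 - α ^ 2) * (y * y') ^ 2 * (y' - yT) ^ 2 :=
    mul_le_mul_of_nonneg_left h1.le (by positivity)
  have : xA ^ 2 * ((y - yT) * y') ^ 2 < xA ^ 2 * ((y' - yT) * y) ^ 2 :=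
    mul_lt_mul_of_pos_left h2 (by positivity)
  linarith

theorem IsY2.unique (hα0 : 0 ≤ α) (hα1 : α < 1) (hA : 0 < xA) (hT : 0 ≤ yT)
    (hE : 0 < yT ∨ (0 < xT ∧ CanEscape α xA xT yT)) {y y' : ℝ}
    (h : IsY2 α xA xT yT y) (h' : IsY2 α xA xT yT y') : y = y' := by
  rcases hT.lt_or_eq with hy | hy
  · exact le_antisymm (h'.le hα0 hα1 hA hy h) (h.le hα0 hα1 hA hy h')
  · obtain ⟨hx, hE⟩ := hE.resolve_left (by simp [← hy])
    have hα : 0 < 1 - α ^ 2 := by nlinarith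
    have hlt : α ^ 2 * xT ^ 2 < xA ^ 2 := by
      have := hE.resolve_left hx.not_gt
      simp only [← hy, ne_eq, OfNat.ofNat_ne_zero, not_false_eq_true, zero_pow, zero_div,
        add_zero] at this
      have hα2 : α ^ 2 ≤ 1 := by nlinarith
      have : α ^ 2 * xT ^ 2 ≤ α ^ 2 * (α ^ 2 * xA ^ 2) := by gcongr
      have : α ^ 2 * (α ^ 2 * xA ^ 2) ≤ 1 * (1 * xA ^ 2) := by gcongr
      have : xT ^ 2 < 1 * xA ^ 2 := by
        have : α ^ 2 * xA ^ 2 ≤ 1 * xA ^ 2 := by gcongr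
        linarith
      nlinarith [sq_nonneg xT]
    -- for `yT = 0` the quartic is `y ^ 2` times a positive factor
    have aux : ∀ z, IsY2 α xA xT yT z → z = 0 := by
      rintro z ⟨e, -⟩
      rw [quartic_eq_sub, ← hy] at e
      have e2 : z ^ 2 * ((1 - α ^ 2) * z ^ 2 + (xA ^ 2 - α ^ 2 * xT ^ 2)) = 0 := by
        linear_combination e
      have hpos : 0 < (1 - α ^ 2) * z ^ 2 + (xA ^ 2 - α ^ 2 * xT ^ 2) := by
        have : 0 ≤ (1 - α ^ 2) * z ^ 2 := by positivity
        linarith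
      simpa using (mul_eq_zero.1 e2).resolve_right hpos.ne'
    rw [aux y h, aux y' h']

theorem exists_isAimpoint (hα0 : 0 ≤ α) (hα1 : α < 1) (hT : 0 ≤ yT) :
    ∃ y, IsAimpoint α xA xT yT y := by
  rcases le_or_gt xT 0 with hx | hx
  · obtain ⟨y, h⟩ := exists_isY1 (α := α) (xA := xA) (xT := xT) hT
    exact ⟨y, fun _ => h, fun h' => absurd h' hx.not_gt⟩
  · obtain ⟨y, h⟩ := exists_isY2 (xA := xA) (xT := xT) (yT := yT) hα0 hα1
    exact ⟨y, fun h' => absurd h' hx.not_ge, fun _ => h⟩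

theorem IsAimpoint.unique (hα0 : 0 ≤ α) (hα1 : α < 1) (hA : 0 < xA) (hT : 0 ≤ yT)
    (hE : CanEscape α xA xT yT) {y y' : ℝ}
    (h : IsAimpoint α xA xT yT y) (h' : IsAimpoint α xA xT yT y') : y = y' := by
  rcases le_or_gt xT 0 with hx | hx
  · exact (h.1 hx).unique hα0 hα1 hA (h'.1 hx)
  · exact (h.2 hx).unique hα0 hα1 hA hT (Or.inr ⟨hx, hE⟩) (h'.2 hx)

end Roots

/-! ### Smooth coordinates on the escape region -/

/-- Coordinates of a state of the escape region.  The unit vector `a` points from `D` to `A`;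
`τ` is the time that `A` and `D` need to reach the aimpoint `P`, and `q`, `c` are sine and
cosine of the angle under which they see it, with `q` signed, so that no reflection of the
frame is needed.  By the stationarity condition the target runs in the direction with
coordinates `(-κ, α * q)`; it lies on the line through `P` in this direction, `σ` beyond `P`,
so that `σ < 0` means that it has not reached `P` yet.  The final distance of `A` and `T` will
be `α * τ + σ`. -/
structure Aim (α : ℝ) (s : GameState) where
  a : ℂ
  q : ℝ
  c : ℝ
  κ : ℝ
  τ : ℝ
  σ : ℝ
  norm_a : ‖a‖ = 1
  c_pos : 0 < c
  c_sq : c ^ 2 + q ^ 2 = 1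
  κ_pos : 0 < κ
  κ_sq : κ ^ 2 + α ^ 2 * q ^ 2 = 1
  τ_pos : 0 < τ
  payoff_pos : 0 < α * τ + σ
  sub_eq : s.A - s.D = a * ((2 * τ * c : ℝ) : ℂ)
  target_eq : s.T - (s.A + s.D) / 2 = a * (⟨-σ * κ, q * (τ + α * σ)⟩ : ℂ)

/-- The escape condition is the positivity of the final distance, for a target with `0 < xT`. -/
theorem CanEscape.lt_of_isAimpoint {α q c κ τ ρ : ℝ} (hα0 : 0 ≤ α) (hα1 : α < 1)
    (hq : 0 ≤ q) (hcq : c ^ 2 + q ^ 2 = 1) (hκ : 0 < κ) (hκq : κ ^ 2 + α ^ 2 * q ^ 2 = 1)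
    (hτ : 0 < τ) (hρ : 0 < ρ) (hT : 0 ≤ q * (τ - α * ρ))
    (hE : CanEscape α (τ * c) (ρ * κ) (q * (τ - α * ρ))) : ρ < α * τ := by
  have hα : 0 < 1 - α ^ 2 := by nlinarith
  have hE := hE.resolve_left (by positivity : 0 < ρ * κ).not_gt
  rw [← mul_lt_mul_iff_of_pos_right hα, mul_assoc _ _ (1 - α ^ 2), add_mul,
    div_mul_cancel₀ _ hα.ne'] at hE
  have hc : c ^ 2 = 1 - q ^ 2 := by linarith
  have hk : κ ^ 2 = 1 - α ^ 2 * q ^ 2 := by linarith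
  -- the escape condition factors, and the second factor is positive because `yT ≥ 0`
  have hprod : (ρ - α * τ) * ((1 - α ^ 2 - α ^ 2 * q ^ 2) * ρ +
      α * τ * (1 - α ^ 2 + α ^ 2 * q ^ 2)) < 0 := by
    have e : (ρ * κ) ^ 2 * (1 - α ^ 2) - α ^ 2 * ((τ * c) ^ 2 * (1 - α ^ 2) +
        (q * (τ - α * ρ)) ^ 2) = (ρ - α * τ) * ((1 - α ^ 2 - α ^ 2 * q ^ 2) * ρ +
      α * τ * (1 - α ^ 2 + α ^ 2 * q ^ 2)) := by
      rw [mul_pow, mul_pow τ c, hc, hk]; ring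
    linarith
  by_contra! hle
  refine hprod.not_ge (mul_nonneg (by linarith) ?_)
  rcases hq.lt_or_eq with hq | hq
  · have h1 : α * ρ ≤ τ := by nlinarith [nonneg_of_mul_nonneg_right hT hq]
    have h2 : α * q ^ 2 * (α * ρ) ≤ α * q ^ 2 * τ := by gcongr
    have hq1 : q ^ 2 ≤ 1 := by nlinarith [sq_nonneg c]
    have h3 : 0 ≤ (1 - α ^ 2) * ρ := by positivity
    have h4 : (1 - α ^ 2) * (α * τ) ≤ (1 - α ^ 2) * ρ := by gcongr
    have h5 : α * τ * (1 - α ^ 2) * (1 - q ^ 2) ≥ 0 :=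
      mul_nonneg (by positivity) (by linarith)
    have h6 : 0 ≤ α * τ * (1 - α ^ 2) := by positivity
    nlinarith
  · rw [← hq]
    have h3 : 0 ≤ (1 - α ^ 2) * ρ := by positivity
    have h6 : 0 ≤ α * τ * (1 - α ^ 2) := by positivity
    nlinarith

/-- The coordinates of `Aim` in the reduced frame. -/
theorem IsAimpoint.exists_coordinates {α xA xT yT y : ℝ} (hα0 : 0 ≤ α) (hα1 : α < 1)
    (hA : 0 < xA) (hT : 0 ≤ yT) (hE : CanEscape α xA xT yT) (h : IsAimpoint α xA xT yT y) :
    ∃ q c κ τ σ : ℝ, 0 < c ∧ c ^ 2 + q ^ 2 = 1 ∧ 0 < κ ∧ κ ^ 2 + α ^ 2 * q ^ 2 = 1 ∧ 0 < τ ∧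
      0 < α * τ + σ ∧ xA = τ * c ∧ xT = -σ * κ ∧ yT = q * (τ + α * σ) := by
  have hy0 : 0 ≤ y := by
    rcases le_or_gt xT 0 with hx | hx
    · exact (h.1 hx).2.1
    · exact hT.trans (h.2 hx).2
  have he : quartic α xA xT yT y = 0 := by
    rcases le_or_gt xT 0 with hx | hx
    · exact (h.1 hx).1
    · exact (h.2 hx).1
  obtain ⟨τ, hτ, hτ2⟩ : ∃ τ, 0 < τ ∧ τ ^ 2 = xA ^ 2 + y ^ 2 :=
    ⟨√(xA ^ 2 + y ^ 2), by positivity, Real.sq_sqrt (by positivity)⟩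
  obtain ⟨d, hd, hd2⟩ : ∃ d, 0 ≤ d ∧ d ^ 2 = xT ^ 2 + (yT - y) ^ 2 :=
    ⟨√(xT ^ 2 + (yT - y) ^ 2), by positivity, Real.sq_sqrt (by positivity)⟩
  obtain ⟨q, rfl⟩ : ∃ q, y = τ * q := ⟨y / τ, by field_simp⟩
  obtain ⟨c, rfl⟩ : ∃ c, xA = τ * c := ⟨xA / τ, by field_simp⟩
  have hc : 0 < c := pos_of_mul_pos_right hA hτ.le
  have hq : 0 ≤ q := nonneg_of_mul_nonneg_right hy0 hτ
  have hcq : c ^ 2 + q ^ 2 = 1 := by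
    have : τ ^ 2 * (c ^ 2 + q ^ 2 - 1) = 0 := by linear_combination -hτ2
    have := (mul_eq_zero.1 this).resolve_left (by positivity)
    linarith
  have hκ0 : 0 < 1 - α ^ 2 * q ^ 2 := by
    have : α ^ 2 * q ^ 2 ≤ 1 * q ^ 2 := by gcongr; nlinarith
    nlinarith
  obtain ⟨κ, hκ, hκ2⟩ : ∃ κ, 0 < κ ∧ κ ^ 2 + α ^ 2 * q ^ 2 = 1 :=
    ⟨√(1 - α ^ 2 * q ^ 2), by positivity, by rw [Real.sq_sqrt hκ0.le]; ring⟩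
  have hstat : (yT - τ * q) ^ 2 = (α * q * d) ^ 2 := by
    rw [quartic_eq_sub', ← hτ2, ← hd2] at he
    have : τ ^ 2 * ((yT - τ * q) ^ 2 - (α * q * d) ^ 2) = 0 := by linear_combination he
    have := (mul_eq_zero.1 this).resolve_left (by positivity)
    linarith
  have hxT : xT ^ 2 = (d * κ) ^ 2 := by
    have : κ ^ 2 = 1 - α ^ 2 * q ^ 2 := by linarith
    rw [mul_pow, this]; linear_combination -hstat - hd2
  rcases le_or_gt xT 0 with hx | hx
  · have e1 : yT = τ * q + α * q * d := by
      rw [sq_eq_sq₀ (by linarith [(h.1 hx).2.2]) (by positivity)] at hstat; linarith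
    have e2 : xT = -d * κ := by
      rw [← neg_sq, sq_eq_sq₀ (by linarith) (by positivity)] at hxT; linarith
    refine ⟨q, c, κ, τ, d, hc, hcq, hκ, hκ2, hτ, ?_, rfl, e2, by linarith⟩
    rcases hd.lt_or_eq with h0 | h0
    · positivity
    · rw [e2, ← h0] at hE
      rcases hα0.lt_or_eq with hα | hα
      · positivity
      · simp [CanEscape, ← hα] at hE
  · have e1 : yT = q * (τ - α * d) := by
      rw [← neg_sq, sq_eq_sq₀ (by linarith [(h.2 hx).2]) (by positivity)] at hstat; linarith
    have e2 : xT = d * κ := by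
      rwa [sq_eq_sq₀ hx.le (by positivity)] at hxT
    have hd' : 0 < d := hd.lt_of_ne (by rintro rfl; simp [e2] at hx)
    rw [e1, e2] at hE
    have := CanEscape.lt_of_isAimpoint hα0 hα1 hq hcq hκ hκ2 hτ hd' (e1 ▸ hT) hE
    exact ⟨q, c, κ, τ, -d, hc, hcq, hκ, hκ2, hτ, by linarith, rfl, by linarith, by linarith⟩

theorem norm_mk_eq_one {x y : ℝ} (h : x ^ 2 + y ^ 2 = 1) : ‖(⟨x, y⟩ : ℂ)‖ = 1 := by
  rw [← sq_eq_sq₀ (norm_nonneg _) zero_le_one, ← Complex.normSq_eq_norm_sq, Complex.normSq_mk]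
  linarith

namespace GameState

theorem xA_pos {s : GameState} (h : s.A ≠ s.D) : 0 < s.xA := by
  have := norm_pos_iff.2 (sub_ne_zero.2 h)
  unfold xA; positivity

theorem norm_axis {s : GameState} (h : s.A ≠ s.D) : ‖s.axis‖ = 1 := by
  have := norm_ne_zero_iff.2 (sub_ne_zero.2 h)
  unfold axis
  rw [norm_div, Complex.norm_real, norm_norm, div_self this]

theorem axis_ne_zero {s : GameState} (h : s.A ≠ s.D) : s.axis ≠ 0 := by
  rw [← norm_ne_zero_iff, norm_axis h]; exact one_ne_zero

theorem orient_sq (s : GameState) : s.orient * s.orient = 1 := by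
  unfold orient; split_ifs <;> norm_num

theorem yT_eq_abs (s : GameState) : s.yT = |s.rel.im| := by
  unfold yT orient
  split_ifs with h
  · rw [abs_of_neg h]; ring
  · rw [abs_of_nonneg (not_lt.1 h)]; ring

theorem yT_nonneg (s : GameState) : 0 ≤ s.yT := s.yT_eq_abs ▸ abs_nonneg _

theorem exp_orient (s : GameState) (θ : ℝ) :
    Complex.exp ((s.orient * θ : ℝ) * Complex.I) = ⟨Real.cos θ, s.orient * Real.sin θ⟩ := by
  unfold orient
  apply Complex.ext <;> split_ifs <;> simp [Complex.exp_re, Complex.exp_im]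

end GameState

theorem exists_aim {α : ℝ} (hα0 : 0 ≤ α) (hα1 : α < 1) {s : GameState}
    (hs : s ∈ escapeRegion α) : Nonempty (Aim α s) := by
  obtain ⟨hne, hE⟩ := hs
  obtain ⟨y, hy⟩ := exists_isAimpoint (xA := s.xA) (xT := s.xT) hα0 hα1 s.yT_nonneg
  obtain ⟨q, c, κ, τ, σ, hc, hcq, hκ, hκq, hτ, hp, h1, h2, h3⟩ :=
    hy.exists_coordinates hα0 hα1 (GameState.xA_pos hne) s.yT_nonneg hE
  have ho := s.orient_sq
  have ho2 : s.orient ^ 2 = 1 := by rw [sq, ho]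
  refine ⟨⟨s.axis, s.orient * q, c, κ, τ, σ, GameState.norm_axis hne, hc, ?_, hκ, ?_, hτ, hp,
    ?_, ?_⟩⟩
  · rw [mul_pow, ho2]; linarith
  · rw [mul_pow, ho2]; linarith
  · have : ‖s.A - s.D‖ = 2 * τ * c := by unfold GameState.xA at h1; linarith
    rw [← this]
    have := norm_ne_zero_iff.2 (sub_ne_zero.2 hne)
    rw [GameState.axis, div_mul_cancel₀ _ (by exact_mod_cast this)]
  · have hrel : s.rel = ⟨-σ * κ, s.orient * q * (τ + α * σ)⟩ := by
      apply Complex.ext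
      · exact h2
      · have : s.orient * (s.orient * s.rel.im) = s.orient * (q * (τ + α * σ)) := by
          rw [← h3]; rfl
        rw [← mul_assoc, ho, one_mul] at this
        rw [this]; ring
    rw [← hrel, GameState.rel, mul_div_cancel₀ _ (GameState.axis_ne_zero hne)]

namespace Aim

variable {α : ℝ} {s : GameState} (m : Aim α s)

/-- The direction from the attacker to the aimpoint. -/
def dirA : ℂ := m.a * ⟨-m.c, m.q⟩

/-- The direction from the defender to the aimpoint. -/
def dirD : ℂ := m.a * ⟨m.c, m.q⟩

/-- The direction in which the target runs. -/
def dirT : ℂ := m.a * ⟨-m.κ, α * m.q⟩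

theorem norm_dirA : ‖m.dirA‖ = 1 := by
  rw [dirA, norm_mul, m.norm_a, norm_mk_eq_one (by rw [neg_sq, m.c_sq]), one_mul]

theorem norm_dirD : ‖m.dirD‖ = 1 := by
  rw [dirD, norm_mul, m.norm_a, norm_mk_eq_one m.c_sq, one_mul]

theorem norm_dirT : ‖m.dirT‖ = 1 := by
  rw [dirT, norm_mul, m.norm_a, norm_mk_eq_one (by rw [neg_sq, mul_pow, m.κ_sq]), one_mul]

include m in
theorem ne : s.A ≠ s.D := by
  rw [← sub_ne_zero, m.sub_eq]
  have h1 := m.norm_a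
  have := m.τ_pos
  have := m.c_pos
  refine mul_ne_zero (fun h => by simp [h] at h1) ?_
  rw [Complex.ofReal_ne_zero]
  positivity

theorem norm_sub : ‖s.A - s.D‖ = 2 * m.τ * m.c := by
  have := m.τ_pos
  have := m.c_pos
  rw [m.sub_eq, norm_mul, m.norm_a, one_mul, Complex.norm_real, Real.norm_of_nonneg (by positivity)]

theorem a_ne_zero : m.a ≠ 0 := by
  rw [← norm_ne_zero_iff, m.norm_a]; exact one_ne_zero

theorem axis_eq : s.axis = m.a := by
  have h := norm_ne_zero_iff.2 (sub_ne_zero.2 m.ne)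
  unfold GameState.axis
  rw [div_eq_iff (by exact_mod_cast h), m.norm_sub, m.sub_eq]

theorem rel_eq : s.rel = ⟨-m.σ * m.κ, m.q * (m.τ + α * m.σ)⟩ := by
  rw [GameState.rel, m.axis_eq, m.target_eq, mul_div_cancel_left₀ _ m.a_ne_zero]

theorem xA_eq : s.xA = m.τ * m.c := by
  rw [GameState.xA, m.norm_sub]; ring

theorem xT_eq : s.xT = -m.σ * m.κ := by rw [GameState.xT, m.rel_eq]

theorem height_pos (hα0 : 0 ≤ α) (hα1 : α < 1) : 0 < m.τ + α * m.σ := by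
  have := m.payoff_pos
  have := m.τ_pos
  have : 0 < (1 - α ^ 2) * m.τ := mul_pos (by nlinarith) m.τ_pos
  nlinarith

theorem yT_eq (hα0 : 0 ≤ α) (hα1 : α < 1) : s.yT = |m.q| * (m.τ + α * m.σ) := by
  rw [s.yT_eq_abs, m.rel_eq, abs_mul, abs_of_pos (m.height_pos hα0 hα1)]

theorem orient_mul_abs (hα0 : 0 ≤ α) (hα1 : α < 1) : s.orient * |m.q| = m.q := by
  have h := m.height_pos hα0 hα1
  unfold GameState.orient
  rw [m.rel_eq]
  split_ifs with h'
  · have : m.q < 0 := by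
      by_contra! h0
      exact h'.not_ge (mul_nonneg h0 h.le)
    rw [abs_of_neg this]; ring
  · have : 0 ≤ m.q := by
      by_contra! h0
      exact h' (mul_neg_of_neg_of_pos h0 h)
    rw [abs_of_nonneg this, one_mul]

theorem isAimpoint (hα0 : 0 ≤ α) (hα1 : α < 1) :
    IsAimpoint α s.xA s.xT s.yT (m.τ * |m.q|) := by
  have hτ := m.τ_pos
  have hκ := m.κ_pos
  have e : quartic α s.xA s.xT s.yT (m.τ * |m.q|) = 0 := by
    have h1 : m.c ^ 2 = 1 - |m.q| ^ 2 := by rw [sq_abs]; linarith [m.c_sq]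
    have h2 : m.κ ^ 2 = 1 - α ^ 2 * |m.q| ^ 2 := by rw [sq_abs]; linarith [m.κ_sq]
    rw [quartic_eq_sub', m.yT_eq hα0 hα1, m.xA_eq, m.xT_eq, mul_pow m.τ m.c, mul_pow _ m.κ, h1, h2]
    ring
  refine ⟨fun hx => ⟨e, by positivity, ?_⟩, fun hx => ⟨e, ?_⟩⟩
  · rw [m.xT_eq] at hx
    have hσ : 0 ≤ m.σ := by
      by_contra! h
      nlinarith [mul_pos (neg_pos.2 h) hκ]
    rw [m.yT_eq hα0 hα1]
    nlinarith [mul_nonneg (abs_nonneg m.q) (mul_nonneg hα0 hσ)]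
  · rw [m.xT_eq] at hx
    have hσ : 0 ≤ -m.σ := (pos_of_mul_pos_left hx hκ.le).le
    rw [m.yT_eq hα0 hα1]
    nlinarith [mul_nonneg (abs_nonneg m.q) (mul_nonneg hα0 hσ)]

theorem sqrt_eq : √(s.xA ^ 2 + (m.τ * |m.q|) ^ 2) = m.τ := by
  have : s.xA ^ 2 + (m.τ * |m.q|) ^ 2 = m.τ ^ 2 := by
    rw [m.xA_eq, mul_pow, mul_pow, sq_abs]
    linear_combination m.τ ^ 2 * m.c_sq
  rw [this, Real.sqrt_sq m.τ_pos.le]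

end Aim

/-! ### The feedback laws in these coordinates -/

theorem exists_cos_sin {x y : ℝ} (h : x ^ 2 + y ^ 2 = 1) :
    ∃ θ, Real.cos θ = x ∧ Real.sin θ = y := by
  have hn := norm_mk_eq_one h
  refine ⟨(⟨x, y⟩ : ℂ).arg, ?_, ?_⟩
  · rw [Complex.cos_arg (by rw [← norm_ne_zero_iff, hn]; exact one_ne_zero), hn, div_one]
  · rw [Complex.sin_arg, hn, div_one]

namespace Aim

variable {α : ℝ} {s : GameState} (m : Aim α s)

theorem corresponds_iff {χ θ : ℝ} : s.Corresponds χ θ ↔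
    Complex.exp (χ * Complex.I) = m.a * ⟨Real.cos θ, s.orient * Real.sin θ⟩ := by
  rw [GameState.Corresponds, s.exp_orient, m.axis_eq]

theorem isAimpoint_iff (hα0 : 0 ≤ α) (hα1 : α < 1) (hs : s ∈ escapeRegion α) {y : ℝ} :
    IsAimpoint α s.xA s.xT s.yT y ↔ y = m.τ * |m.q| :=
  ⟨fun h => h.unique hα0 hα1 (GameState.xA_pos hs.1) s.yT_nonneg hs.2 (m.isAimpoint hα0 hα1),
    fun h => h ▸ m.isAimpoint hα0 hα1⟩

theorem attackerHeading_iff (hα0 : 0 ≤ α) (hα1 : α < 1) (hs : s ∈ escapeRegion α) {θ : ℝ} :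
    AttackerHeading α s.xA s.xT s.yT θ ↔ Real.cos θ = -m.c ∧ Real.sin θ = |m.q| := by
  have := m.τ_pos.ne'
  simp only [AttackerHeading, m.isAimpoint_iff hα0 hα1 hs, exists_eq_left, m.sqrt_eq,
    mul_div_cancel_left₀ _ this]
  rw [m.xA_eq, mul_div_cancel_left₀ _ this]

theorem defenderHeading_iff (hα0 : 0 ≤ α) (hα1 : α < 1) (hs : s ∈ escapeRegion α) {θ : ℝ} :
    DefenderHeading α s.xA s.xT s.yT θ ↔ Real.cos θ = m.c ∧ Real.sin θ = |m.q| := by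
  have := m.τ_pos.ne'
  simp only [DefenderHeading, m.isAimpoint_iff hα0 hα1 hs, exists_eq_left, m.sqrt_eq,
    mul_div_cancel_left₀ _ this]
  rw [m.xA_eq, mul_div_cancel_left₀ _ this]

theorem sqrt_target (hα0 : 0 ≤ α) (hα1 : α < 1) :
    √(s.xT ^ 2 + (s.yT - m.τ * |m.q|) ^ 2) = |m.σ| := by
  have h2 : m.κ ^ 2 = 1 - α ^ 2 * |m.q| ^ 2 := by rw [sq_abs]; linarith [m.κ_sq]
  have e : s.xT ^ 2 + (s.yT - m.τ * |m.q|) ^ 2 = m.σ ^ 2 := by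
    rw [m.yT_eq hα0 hα1, m.xT_eq, mul_pow _ m.κ, h2]
    ring
  rw [e, Real.sqrt_sq_eq_abs]

theorem mul_abs_q_mem (hα0 : 0 ≤ α) : 0 ≤ α * |m.q| ∧ α * |m.q| < 1 := by
  refine ⟨by positivity, ?_⟩
  rw [← sq_lt_one_iff₀ (by positivity), mul_pow, sq_abs]
  have := m.κ_pos
  nlinarith [m.κ_sq]

/-- A target on the bisector of `AD` is at the aimpoint, and its law gives the limiting
direction. -/
theorem targetHeading_zero (hα0 : 0 ≤ α) (hα1 : α < 1) (hx : s.xT = 0) {φ' : ℝ}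
    (h0 : 0 < φ') (h1 : φ' ≤ Real.pi / 2) :
    ((α * s.yT ≠ 0 → Real.tan φ' = √(s.xA ^ 2 + (1 - α ^ 2) * s.yT ^ 2) / (α * s.yT)) ∧
      (α * s.yT = 0 → φ' = Real.pi / 2)) ↔
    Real.cos φ' = α * |m.q| ∧ Real.sin φ' = m.κ := by
  have hτ := m.τ_pos
  have hκ := m.κ_pos
  have hσ : m.σ = 0 := by
    rw [m.xT_eq] at hx
    simpa using (mul_eq_zero.1 hx).resolve_right hκ.ne'
  have hy : s.yT = m.τ * |m.q| := by rw [m.yT_eq hα0 hα1, hσ]; ring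
  have hκq : m.κ ^ 2 + (α * |m.q|) ^ 2 = 1 := by rw [mul_pow, sq_abs]; exact m.κ_sq
  have hs : √(s.xA ^ 2 + (1 - α ^ 2) * s.yT ^ 2) = m.τ * m.κ := by
    rw [show s.xA ^ 2 + (1 - α ^ 2) * s.yT ^ 2 = (m.τ * m.κ) ^ 2 by
      rw [hy, m.xA_eq, mul_pow, mul_pow, mul_pow, sq_abs]
      linear_combination m.τ ^ 2 * (m.c_sq - m.κ_sq), Real.sqrt_sq (by positivity)]
  rw [hs, hy, show α * (m.τ * |m.q|) = m.τ * (α * |m.q|) by ring,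
    mul_div_mul_left _ _ hτ.ne', mul_ne_zero_iff, mul_eq_zero, or_iff_right hτ.ne',
    and_iff_right hτ.ne']
  have hb := m.mul_abs_q_mem hα0
  have hsin : 0 < Real.sin φ' := Real.sin_pos_of_pos_of_lt_pi h0 (by linarith [Real.pi_pos])
  have hcos : 0 ≤ Real.cos φ' := Real.cos_nonneg_of_mem_Icc ⟨by linarith [Real.pi_pos], h1⟩
  have hsc := Real.sin_sq_add_cos_sq φ'
  constructor
  · rintro ⟨h2, h3⟩
    by_cases hq : α * |m.q| = 0
    · rw [h3 hq, hq, Real.cos_pi_div_two, Real.sin_pi_div_two]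
      rw [hq] at hκq
      exact ⟨rfl, by nlinarith⟩
    · have hpos : 0 < α * |m.q| := hb.1.lt_of_ne (Ne.symm hq)
      have ht := h2 hq
      have hc0 : Real.cos φ' ≠ 0 := by
        intro h
        rw [Real.tan_eq_sin_div_cos, h, div_zero, eq_comm, div_eq_zero_iff] at ht
        exact ht.elim hκ.ne' hq
      rw [Real.tan_eq_sin_div_cos, div_eq_div_iff hc0 hq] at ht
      have hcq : Real.cos φ' ^ 2 = (α * |m.q|) ^ 2 := by
        have : (Real.sin φ' * (α * |m.q|)) ^ 2 = (m.κ * Real.cos φ') ^ 2 := by rw [ht]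
        rw [mul_pow, mul_pow m.κ] at this
        have e1 : Real.sin φ' ^ 2 = 1 - Real.cos φ' ^ 2 := by linarith
        have e2 : m.κ ^ 2 = 1 - (α * |m.q|) ^ 2 := by linarith
        rw [e1, e2] at this
        linarith
      rw [sq_eq_sq₀ hcos hb.1] at hcq
      refine ⟨hcq, ?_⟩
      rw [hcq] at ht
      exact mul_right_cancel₀ hq ht
  · rintro ⟨h2, h3⟩
    refine ⟨fun _ => by rw [Real.tan_eq_sin_div_cos, h2, h3], fun hq => ?_⟩
    rw [hq] at h2
    by_contra hne
    exact (Real.cos_pos_of_mem_Ioo ⟨by linarith [Real.pi_pos], lt_of_le_of_ne h1 hne⟩).ne' h2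

theorem cos_sin_of_targetHeading (hα0 : 0 ≤ α) (hα1 : α < 1) (hs : s ∈ escapeRegion α) {θ : ℝ}
    (h : TargetHeading α s.xA s.xT s.yT θ) : Real.cos θ = -m.κ ∧ Real.sin θ = α * |m.q| := by
  have hκ := m.κ_pos
  simp only [TargetHeading, m.isAimpoint_iff hα0 hα1 hs, exists_eq_left,
    m.sqrt_target hα0 hα1] at h
  obtain ⟨h1, h2, h3⟩ := h
  have hyT := m.yT_eq hα0 hα1
  rcases lt_trichotomy m.σ 0 with hσ | hσ | hσ
  · obtain ⟨h4, h5⟩ := h2 (by rw [m.xT_eq]; exact mul_pos (by linarith) hκ)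
    rw [h4, h5, m.xT_eq, hyT, abs_of_neg hσ]
    have := hσ.ne
    constructor
    · field_simp
    · field_simp
      ring
  · have hx : s.xT = 0 := by rw [m.xT_eq, hσ]; ring
    obtain ⟨φ', h4, h5, h6, h7, rfl⟩ := h3 hx
    obtain ⟨h8, h9⟩ := (m.targetHeading_zero hα0 hα1 hx h4 h5).1 ⟨h6, h7⟩
    rw [Real.cos_add_pi_div_two, Real.sin_add_pi_div_two, h8, h9]
    exact ⟨rfl, rfl⟩
  · obtain ⟨h4, h5⟩ := h1 (by rw [m.xT_eq]; exact mul_neg_of_neg_of_pos (by linarith) hκ)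
    rw [h4, h5, m.xT_eq, hyT, abs_of_pos hσ]
    constructor
    · field_simp
    · field_simp
      ring

theorem exists_targetHeading (hα0 : 0 ≤ α) (hα1 : α < 1) :
    ∃ θ, TargetHeading α s.xA s.xT s.yT θ ∧ Real.cos θ = -m.κ ∧ Real.sin θ = α * |m.q| := by
  have hκ := m.κ_pos
  have hb := m.mul_abs_q_mem hα0
  have hκq : m.κ ^ 2 + (α * |m.q|) ^ 2 = 1 := by rw [mul_pow, sq_abs]; exact m.κ_sq
  have hcos : Real.cos (Real.arccos (α * |m.q|)) = α * |m.q| :=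
    Real.cos_arccos (by linarith) hb.2.le
  have hsin : Real.sin (Real.arccos (α * |m.q|)) = m.κ := by
    rw [Real.sin_arccos, show 1 - (α * |m.q|) ^ 2 = m.κ ^ 2 by linarith, Real.sqrt_sq hκ.le]
  have h0 : 0 < Real.arccos (α * |m.q|) := Real.arccos_pos.2 hb.2
  have h1 : Real.arccos (α * |m.q|) ≤ Real.pi / 2 := Real.arccos_le_pi_div_two.2 hb.1
  have hyT := m.yT_eq hα0 hα1
  refine ⟨Real.arccos (α * |m.q|) + Real.pi / 2, ⟨fun hx => ⟨_, m.isAimpoint hα0 hα1, ?_⟩,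
    fun hx => ⟨_, m.isAimpoint hα0 hα1, ?_⟩, fun hx => ⟨_, h0, h1, ?_⟩⟩, ?_⟩
  · have hσ : 0 < m.σ := by
      rw [m.xT_eq] at hx
      by_contra! h
      exact hx.not_ge (mul_nonneg (by linarith) hκ.le)
    rw [Real.cos_add_pi_div_two, Real.sin_add_pi_div_two, hcos, hsin, m.sqrt_target hα0 hα1,
      m.xT_eq, hyT, abs_of_pos hσ]
    constructor
    · field_simp
    · field_simp
      ring
  · have hσ : m.σ < 0 := by
      rw [m.xT_eq] at hx
      have := pos_of_mul_pos_left hx hκ.le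
      linarith
    rw [Real.cos_add_pi_div_two, Real.sin_add_pi_div_two, hcos, hsin, m.sqrt_target hα0 hα1,
      m.xT_eq, hyT, abs_of_neg hσ]
    have := hσ.ne
    constructor
    · field_simp
    · field_simp
      ring
  · obtain ⟨h2, h3⟩ := (m.targetHeading_zero hα0 hα1 hx h0 h1).2 ⟨hcos, hsin⟩
    exact ⟨h2, h3, rfl⟩
  · rw [Real.cos_add_pi_div_two, Real.sin_add_pi_div_two, hcos, hsin]
    exact ⟨rfl, rfl⟩

theorem attackerLaw_iff (hα0 : 0 ≤ α) (hα1 : α < 1) (hs : s ∈ escapeRegion α) {χ : ℝ} :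
    AttackerLaw α s χ ↔ Complex.exp (χ * Complex.I) = m.dirA := by
  have ho := m.orient_mul_abs hα0 hα1
  simp only [AttackerLaw, m.attackerHeading_iff hα0 hα1 hs, m.corresponds_iff]
  constructor
  · rintro ⟨θ, ⟨h1, h2⟩, h⟩
    rw [h, h1, h2, ho, dirA]
  · intro h
    obtain ⟨θ, h1, h2⟩ := exists_cos_sin (x := -m.c) (y := |m.q|)
      (by rw [neg_sq, sq_abs, m.c_sq])
    exact ⟨θ, ⟨h1, h2⟩, by rw [h, h1, h2, ho, dirA]⟩

theorem defenderLaw_iff (hα0 : 0 ≤ α) (hα1 : α < 1) (hs : s ∈ escapeRegion α) {ψ : ℝ} :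
    DefenderLaw α s ψ ↔ Complex.exp (ψ * Complex.I) = m.dirD := by
  have ho := m.orient_mul_abs hα0 hα1
  simp only [DefenderLaw, m.defenderHeading_iff hα0 hα1 hs, m.corresponds_iff]
  constructor
  · rintro ⟨θ, ⟨h1, h2⟩, h⟩
    rw [h, h1, h2, ho, dirD]
  · intro h
    obtain ⟨θ, h1, h2⟩ := exists_cos_sin (x := m.c) (y := |m.q|) (by rw [sq_abs, m.c_sq])
    exact ⟨θ, ⟨h1, h2⟩, by rw [h, h1, h2, ho, dirD]⟩

theorem targetLaw_iff (hα0 : 0 ≤ α) (hα1 : α < 1) (hs : s ∈ escapeRegion α) {φ : ℝ} :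
    TargetLaw α s φ ↔ Complex.exp (φ * Complex.I) = m.dirT := by
  have ho : s.orient * (α * |m.q|) = α * m.q := by
    rw [← m.orient_mul_abs hα0 hα1, abs_mul, abs_abs]
    unfold GameState.orient
    split_ifs <;> simp
  simp only [TargetLaw, m.corresponds_iff]
  constructor
  · rintro ⟨θ, hθ, h⟩
    obtain ⟨h1, h2⟩ := m.cos_sin_of_targetHeading hα0 hα1 hs hθ
    rw [h, h1, h2, ho, dirT]
  · intro h
    obtain ⟨θ, hθ, h1, h2⟩ := m.exists_targetHeading hα0 hα1
    exact ⟨θ, hθ, by rw [h, h1, h2, ho, dirT]⟩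

end Aim

/-! ### The value as a supremum over directions -/

/-- The position of `T` relative to the midpoint of `AD`, in the frame of `axis`, multiplied by
the distance of `A` and `D`: this makes it a polynomial in the positions. -/
def offset (s : GameState) : ℂ := (s.T - (s.A + s.D) / 2) * (starRingEnd ℂ) (s.A - s.D)

/-- The distance of `A` and `D` times
`α * √(1 - q ^ 2) * xA + α * q * yT - √(1 - α ^ 2 * q ^ 2) * xT`, where `yT` carries its sign.
At the states whose aimpoint is seen by `A` and `D` under the angle with sine `q`, the displayed
linear function is the final distance of `A` and `T`. -/
def payoff (α q : ℝ) (s : GameState) : ℝ :=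
  α * √(1 - q ^ 2) * (‖s.A - s.D‖ ^ 2 / 2) - √(1 - α ^ 2 * q ^ 2) * (offset s).re +
    α * q * (offset s).im

/-- The distance of `A` and `D` times `value`. -/
def scaledValue (α : ℝ) (s : GameState) : ℝ := ⨆ q : Icc (-1 : ℝ) 1, payoff α q s

/-- The distance of `A` and `T` at the end of optimal play from a state of the escape region, see
`Aim.value_eq`; half its square is the value of the game. -/
def value (α : ℝ) (s : GameState) : ℝ := scaledValue α s / ‖s.A - s.D‖

section Value

variable {α : ℝ}

theorem sq_mul_sq_le_one (hα0 : 0 ≤ α) (hα1 : α < 1) {q : ℝ} (hq : q ∈ Icc (-1 : ℝ) 1) :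
    α ^ 2 * q ^ 2 ≤ q ^ 2 ∧ q ^ 2 ≤ 1 := by
  have h1 : q ^ 2 ≤ 1 := by nlinarith [hq.1, hq.2]
  have h2 : α ^ 2 * q ^ 2 ≤ 1 * q ^ 2 := by gcongr; nlinarith
  exact ⟨by linarith, h1⟩

theorem abs_lin_comb_le_norm {x y : ℝ} (h : x ^ 2 + y ^ 2 = 1) (z : ℂ) :
    |x * z.re + y * z.im| ≤ ‖z‖ := by
  refine abs_le_of_sq_le_sq ?_ (norm_nonneg _)
  rw [← Complex.normSq_eq_norm_sq, Complex.normSq_apply]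
  nlinarith [sq_nonneg (x * z.im - y * z.re), sq_nonneg z.re, sq_nonneg z.im]

theorem payoff_le (hα0 : 0 ≤ α) (hα1 : α < 1) {q : ℝ} (hq : q ∈ Icc (-1 : ℝ) 1)
    (s : GameState) : payoff α q s ≤ ‖s.A - s.D‖ * ‖s.A - s.T‖ := by
  obtain ⟨h1, h2⟩ := sq_mul_sq_le_one hα0 hα1 hq
  set k := √(1 - α ^ 2 * q ^ 2) with hk
  have hk2 : k ^ 2 = 1 - α ^ 2 * q ^ 2 := Real.sq_sqrt (by linarith)
  have hck : α * √(1 - q ^ 2) ≤ k := by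
    calc α * √(1 - q ^ 2) ≤ 1 * √(1 - q ^ 2) := by gcongr
      _ ≤ k := by rw [one_mul]; exact Real.sqrt_le_sqrt (by linarith)
  have e : offset s = ((‖s.A - s.D‖ ^ 2 / 2 : ℝ) : ℂ) -
      (s.A - s.T) * (starRingEnd ℂ) (s.A - s.D) := by
    have := Complex.mul_conj (s.A - s.D)
    rw [Complex.normSq_eq_norm_sq] at this
    push_cast at this ⊢
    rw [offset, ← this]
    ring
  have h3 := abs_lin_comb_le_norm (x := k) (y := -(α * q)) (by rw [hk2]; ring)
    ((s.A - s.T) * (starRingEnd ℂ) (s.A - s.D))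
  rw [norm_mul, RCLike.norm_conj] at h3
  have h4 := (le_abs_self _).trans h3
  have h5 : α * √(1 - q ^ 2) * (‖s.A - s.D‖ ^ 2 / 2) ≤ k * (‖s.A - s.D‖ ^ 2 / 2) := by gcongr
  rw [payoff, e, Complex.sub_re, Complex.sub_im, Complex.ofReal_re, Complex.ofReal_im, ← hk]
  linarith

theorem bddAbove_payoff (hα0 : 0 ≤ α) (hα1 : α < 1) (s : GameState) :
    BddAbove (range fun q : Icc (-1 : ℝ) 1 => payoff α q s) :=
  ⟨_, by rintro _ ⟨q, rfl⟩; exact payoff_le hα0 hα1 q.2 s⟩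

instance : Nonempty (Icc (-1 : ℝ) 1) := ⟨⟨0, by norm_num⟩⟩

theorem payoff_le_scaledValue (hα0 : 0 ≤ α) (hα1 : α < 1) {q : ℝ} (hq : q ∈ Icc (-1 : ℝ) 1)
    (s : GameState) : payoff α q s ≤ scaledValue α s :=
  le_ciSup (bddAbove_payoff hα0 hα1 s) ⟨q, hq⟩

theorem payoff_sub_le (hα0 : 0 ≤ α) (hα1 : α < 1) {q : ℝ} (hq : q ∈ Icc (-1 : ℝ) 1)
    (s s' : GameState) : payoff α q s - payoff α q s' ≤
      |‖s.A - s.D‖ ^ 2 / 2 - ‖s'.A - s'.D‖ ^ 2 / 2| + ‖offset s - offset s'‖ := by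
  obtain ⟨h1, h2⟩ := sq_mul_sq_le_one hα0 hα1 hq
  have hk2 : √(1 - α ^ 2 * q ^ 2) ^ 2 = 1 - α ^ 2 * q ^ 2 := Real.sq_sqrt (by linarith)
  have h3 := abs_lin_comb_le_norm (x := -√(1 - α ^ 2 * q ^ 2)) (y := α * q)
    (by rw [neg_sq, hk2]; ring) (offset s - offset s')
  have h4 := (le_abs_self _).trans h3
  rw [Complex.sub_re, Complex.sub_im] at h4
  have hc0 : 0 ≤ α * √(1 - q ^ 2) := by positivity
  have hc1 : α * √(1 - q ^ 2) ≤ 1 :=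
    mul_le_one₀ hα1.le (Real.sqrt_nonneg _) (Real.sqrt_le_one.2 (by nlinarith [sq_nonneg q]))
  have h5 : α * √(1 - q ^ 2) * (‖s.A - s.D‖ ^ 2 / 2 - ‖s'.A - s'.D‖ ^ 2 / 2) ≤
      1 * |‖s.A - s.D‖ ^ 2 / 2 - ‖s'.A - s'.D‖ ^ 2 / 2| :=
    (mul_le_mul_of_nonneg_left (le_abs_self _) hc0).trans
      (mul_le_mul_of_nonneg_right hc1 (abs_nonneg _))
  unfold payoff
  linarith

theorem abs_scaledValue_sub_le (hα0 : 0 ≤ α) (hα1 : α < 1) (s s' : GameState) :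
    |scaledValue α s - scaledValue α s'| ≤
      |‖s.A - s.D‖ ^ 2 / 2 - ‖s'.A - s'.D‖ ^ 2 / 2| + ‖offset s - offset s'‖ := by
  have key : ∀ s s' : GameState, scaledValue α s ≤ scaledValue α s' +
      (|‖s.A - s.D‖ ^ 2 / 2 - ‖s'.A - s'.D‖ ^ 2 / 2| + ‖offset s - offset s'‖) := by
    intro s s'
    refine ciSup_le fun q => ?_
    linarith [payoff_sub_le hα0 hα1 q.2 s s', payoff_le_scaledValue hα0 hα1 q.2 s']
  have h1 := key s s'
  have h2 := key s' s
  rw [abs_sub_comm (‖s'.A - s'.D‖ ^ 2 / 2), norm_sub_rev (offset s')] at h2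
  rw [abs_le]
  constructor <;> linarith

theorem value_le_norm_sub (hα0 : 0 ≤ α) (hα1 : α < 1) {s : GameState} (h : s.A ≠ s.D) :
    value α s ≤ ‖s.A - s.T‖ := by
  have := norm_pos_iff.2 (sub_ne_zero.2 h)
  rw [value, div_le_iff₀ this, mul_comm]
  exact ciSup_le fun q => payoff_le hα0 hα1 q.2 s

theorem offset_eq {s : GameState} (h : s.A ≠ s.D) : offset s = ((‖s.A - s.D‖ : ℝ) : ℂ) * s.rel := by
  have h0 : ((‖s.A - s.D‖ : ℝ) : ℂ) ≠ 0 := by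
    exact_mod_cast norm_ne_zero_iff.2 (sub_ne_zero.2 h)
  have hd : s.A - s.D ≠ 0 := sub_ne_zero.2 h
  have := Complex.mul_conj (s.A - s.D)
  rw [Complex.normSq_eq_norm_sq, Complex.ofReal_pow] at this
  rw [offset, GameState.rel, GameState.axis]
  field_simp
  rw [mul_assoc, this]

/-- One half of the characterization of the escape region by the sign of the value; the
condition `CanEscape` is the optimum of a Cauchy–Schwarz inequality. -/
theorem mem_escapeRegion_of_value_pos (hα0 : 0 ≤ α) (hα1 : α < 1) {s : GameState}
    (h : s.A ≠ s.D) (hv : 0 < value α s) : s ∈ escapeRegion α := by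
  refine ⟨h, ?_⟩
  have hn := norm_pos_iff.2 (sub_ne_zero.2 h)
  have hW : 0 < scaledValue α s := by
    rw [value] at hv
    exact (div_pos_iff_of_pos_right hn).1 hv
  obtain ⟨⟨q, hq⟩, hp⟩ := exists_lt_of_lt_ciSup hW
  obtain ⟨h1, h2⟩ := sq_mul_sq_le_one hα0 hα1 hq
  have hα : 0 < 1 - α ^ 2 := by nlinarith
  rcases lt_or_ge s.xT 0 with hx | hx
  · exact Or.inl hx
  refine Or.inr ?_
  have hxA := GameState.xA_pos h
  have hnA : ‖s.A - s.D‖ = 2 * s.xA := by unfold GameState.xA; ring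
  set c := √(1 - q ^ 2) with hc
  have hc2 : c ^ 2 = 1 - q ^ 2 := Real.sq_sqrt (by linarith)
  set k := √(1 - α ^ 2 * q ^ 2) with hk
  have hk2 : k ^ 2 = 1 - α ^ 2 * q ^ 2 := Real.sq_sqrt (by linarith)
  have hk0 : 0 < k := by
    refine Real.sqrt_pos.2 ?_
    rcases h1.lt_or_eq with h | h
    · linarith
    · have : (1 - α ^ 2) * q ^ 2 = 0 := by linarith
      have := (mul_eq_zero.1 this).resolve_left hα.ne'
      rw [this]; norm_num
  have hlt : k * s.xT < α * (c * s.xA + q * s.rel.im) := by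
    simp only [payoff, offset_eq h, Complex.re_ofReal_mul, Complex.im_ofReal_mul, hnA] at hp
    have : 0 < 2 * s.xA * (α * (c * s.xA + q * s.rel.im) - k * s.xT) := by
      rw [GameState.xT]
      linarith
    linarith [pos_of_mul_pos_right this (by positivity)]
  have hsq : (k * s.xT) ^ 2 < (α * (c * s.xA + q * s.rel.im)) ^ 2 :=
    pow_lt_pow_left₀ hlt (by positivity) two_ne_zero
  -- Cauchy–Schwarz for `(c, √(1 - α ^ 2) * q)` and `(xA, yT / √(1 - α ^ 2))`
  have hcs : (c * s.xA + q * s.rel.im) ^ 2 ≤ k ^ 2 * (s.xA ^ 2 + s.yT ^ 2 / (1 - α ^ 2)) := by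
    rw [s.yT_eq_abs, sq_abs]
    have e : k ^ 2 * (s.xA ^ 2 + s.rel.im ^ 2 / (1 - α ^ 2)) - (c * s.xA + q * s.rel.im) ^ 2 =
        ((1 - α ^ 2) * q * s.xA - c * s.rel.im) ^ 2 / (1 - α ^ 2) := by
      have e1 : k ^ 2 = c ^ 2 + (1 - α ^ 2) * q ^ 2 := by rw [hk2, hc2]; ring
      rw [e1]
      field_simp
      ring
    have : 0 ≤ ((1 - α ^ 2) * q * s.xA - c * s.rel.im) ^ 2 / (1 - α ^ 2) := by positivity
    linarith
  have : k ^ 2 * s.xT ^ 2 < k ^ 2 * (α ^ 2 * (s.xA ^ 2 + s.yT ^ 2 / (1 - α ^ 2))) := by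
    rw [mul_pow, mul_pow] at hsq
    have := mul_le_mul_of_nonneg_left hcs (sq_nonneg α)
    linarith
  exact lt_of_mul_lt_mul_left this (by positivity)

/-- For a ray that is refracted, from sines `q`, `q'` to `α * q`, `α * q'` with `α < 1`, the angle
between two directions decreases. -/
theorem cos_sub_le_cos_sub {q q' c c' k k' : ℝ} (hα0 : 0 ≤ α) (hα1 : α < 1)
    (hk : 0 ≤ k) (hk' : 0 ≤ k')
    (h1 : c ^ 2 + q ^ 2 = 1) (h1' : c' ^ 2 + q' ^ 2 = 1)
    (h2 : k ^ 2 + α ^ 2 * q ^ 2 = 1) (h2' : k' ^ 2 + α ^ 2 * q' ^ 2 = 1) :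
    c * c' + q * q' ≤ k * k' + α ^ 2 * q * q' := by
  have hα : 0 < 1 - α ^ 2 := by nlinarith
  suffices h : c * c' + (1 - α ^ 2) * (q * q') ≤ k * k' by linarith
  refine le_of_sq_le_sq ?_ (by positivity)
  have e : (k * k') ^ 2 - (c * c' + (1 - α ^ 2) * (q * q')) ^ 2 =
      (1 - α ^ 2) * (q * c' - q' * c) ^ 2 := by
    linear_combination k' ^ 2 * h2 + (1 - α ^ 2 * q ^ 2) * h2' -
      (c' ^ 2 + (1 - α ^ 2) * q' ^ 2) * h1 - (1 - q ^ 2 + (1 - α ^ 2) * q ^ 2) * h1'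
  have : 0 ≤ (1 - α ^ 2) * (q * c' - q' * c) ^ 2 := by positivity
  linarith

namespace Aim

variable {s : GameState} (m : Aim α s)

theorem q_mem : m.q ∈ Icc (-1 : ℝ) 1 := by
  have := m.c_pos
  constructor <;> nlinarith [m.c_sq]

theorem sqrt_one_sub : √(1 - m.q ^ 2) = m.c := by
  rw [show 1 - m.q ^ 2 = m.c ^ 2 by linarith [m.c_sq], Real.sqrt_sq m.c_pos.le]

theorem sqrt_one_sub' : √(1 - α ^ 2 * m.q ^ 2) = m.κ := by
  rw [show 1 - α ^ 2 * m.q ^ 2 = m.κ ^ 2 by linarith [m.κ_sq], Real.sqrt_sq m.κ_pos.le]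

theorem payoff_eq (q : ℝ) : payoff α q s = 2 * m.τ * m.c *
    (α * m.τ * (m.c * √(1 - q ^ 2) + m.q * q) +
      m.σ * (m.κ * √(1 - α ^ 2 * q ^ 2) + α ^ 2 * m.q * q)) := by
  rw [payoff, offset_eq m.ne, m.rel_eq, m.norm_sub, Complex.re_ofReal_mul, Complex.im_ofReal_mul]
  ring

/-- The angle of the aimpoint maximizes the payoff.  The payoff is `α * τ` times the cosine of an
angle difference plus `σ` times the cosine of the refracted one; for `σ < 0` these compete, and
the first prevails since refraction decreases angles and `-σ < α * τ`. -/
theorem payoff_le_of_mem (hα0 : 0 ≤ α) (hα1 : α < 1) {q : ℝ} (hq : q ∈ Icc (-1 : ℝ) 1) :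
    payoff α q s ≤ 2 * m.τ * m.c * (α * m.τ + m.σ) := by
  have hτ := m.τ_pos
  have hc := m.c_pos
  obtain ⟨h1, h2⟩ := sq_mul_sq_le_one hα0 hα1 hq
  have hc2 : √(1 - q ^ 2) ^ 2 = 1 - q ^ 2 := Real.sq_sqrt (by linarith)
  have hk2 : √(1 - α ^ 2 * q ^ 2) ^ 2 = 1 - α ^ 2 * q ^ 2 := Real.sq_sqrt (by linarith)
  have key := cos_sub_le_cos_sub (q' := q) hα0 hα1 m.κ_pos.le
    (Real.sqrt_nonneg (1 - α ^ 2 * q ^ 2)) m.c_sq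
    (show √(1 - q ^ 2) ^ 2 + q ^ 2 = 1 by linarith) m.κ_sq (by linarith)
  set c' := √(1 - q ^ 2)
  set k' := √(1 - α ^ 2 * q ^ 2)
  have hX : m.c * c' + m.q * q ≤ 1 := by
    nlinarith [sq_nonneg (m.c - c'), sq_nonneg (m.q - q), m.c_sq]
  have hY : m.κ * k' + α ^ 2 * m.q * q ≤ 1 := by
    nlinarith [sq_nonneg (m.κ - k'), sq_nonneg (α * m.q - α * q), m.κ_sq]
  rw [m.payoff_eq]
  refine mul_le_mul_of_nonneg_left ?_ (by positivity)
  have hατ : 0 ≤ α * m.τ := by positivity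
  rcases le_total 0 m.σ with hσ | hσ
  · nlinarith
  · nlinarith [m.payoff_pos]

theorem payoff_q : payoff α m.q s = 2 * m.τ * m.c * (α * m.τ + m.σ) := by
  rw [m.payoff_eq, m.sqrt_one_sub, m.sqrt_one_sub']
  linear_combination (2 * m.τ * m.c) * (α * m.τ * m.c_sq + m.σ * m.κ_sq)

theorem scaledValue_eq (hα0 : 0 ≤ α) (hα1 : α < 1) :
    scaledValue α s = 2 * m.τ * m.c * (α * m.τ + m.σ) :=
  le_antisymm (ciSup_le fun q => m.payoff_le_of_mem hα0 hα1 q.2)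
    (m.payoff_q ▸ payoff_le_scaledValue hα0 hα1 m.q_mem s)

theorem value_eq (hα0 : 0 ≤ α) (hα1 : α < 1) : value α s = α * m.τ + m.σ := by
  have hτ := m.τ_pos
  have hc := m.c_pos
  rw [value, m.scaledValue_eq hα0 hα1, m.norm_sub, mul_div_cancel_left₀ _ (by positivity)]

include m in
theorem mem_escapeRegion (hα0 : 0 ≤ α) (hα1 : α < 1) : s ∈ escapeRegion α :=
  mem_escapeRegion_of_value_pos hα0 hα1 m.ne (m.value_eq hα0 hα1 ▸ m.payoff_pos)

theorem sub_target_eq : s.A - s.T = ((-m.τ : ℝ) : ℂ) * m.dirA - (m.σ : ℂ) * m.dirT := by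
  have h1 : s.A - s.T = (s.A - s.D) / 2 - (s.T - (s.A + s.D) / 2) := by ring
  rw [h1, m.sub_eq, m.target_eq, dirA, dirT, mul_left_comm, mul_left_comm (m.σ : ℂ), mul_div_assoc,
    ← mul_sub, ← mul_sub]
  congr 1
  apply Complex.ext
  · simp; ring
  · simp; ring

theorem norm_sub_target_le (hα0 : 0 ≤ α) (hα1 : α < 1) : ‖s.A - s.T‖ ≤ value α s + 2 * m.τ := by
  have hτ := m.τ_pos
  rw [m.sub_target_eq]
  refine (norm_sub_le _ _).trans ?_
  rw [norm_mul, norm_mul, m.norm_dirA, m.norm_dirT, Complex.norm_real, Complex.norm_real,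
    Real.norm_eq_abs, Real.norm_eq_abs, abs_neg, abs_of_pos hτ, m.value_eq hα0 hα1]
  have : α * m.τ ≤ 1 * m.τ := by gcongr
  have := m.payoff_pos
  have : 0 ≤ α * m.τ := by positivity
  rcases abs_cases m.σ with h | h <;> linarith

end Aim

theorem value_pos (hα0 : 0 ≤ α) (hα1 : α < 1) {s : GameState} (hs : s ∈ escapeRegion α) :
    0 < value α s := by
  obtain ⟨m⟩ := exists_aim hα0 hα1 hs
  exact m.value_eq hα0 hα1 ▸ m.payoff_pos

end Value

/-! ### Absolutely continuous functions -/

open Filter Topology AbsolutelyContinuousOnInterval in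
theorem absolutelyContinuous_of_dist_le {X Y Z : Type*} [PseudoMetricSpace X]
    [PseudoMetricSpace Y] [PseudoMetricSpace Z] {f : ℝ → X} {g : ℝ → Y} {h : ℝ → Z} {a b : ℝ}
    (C : ℝ) (hf : AbsolutelyContinuousOnInterval f a b)
    (hg : AbsolutelyContinuousOnInterval g a b)
    (hh : ∀ x ∈ uIcc a b, ∀ y ∈ uIcc a b,
      dist (h x) (h y) ≤ C * (dist (f x) (f y) + dist (g x) (g y))) :
    AbsolutelyContinuousOnInterval h a b := by
  unfold AbsolutelyContinuousOnInterval at hf hg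
  refine squeeze_zero' ?_ ?_ (by simpa using (hf.add hg).const_mul C)
  · exact Eventually.of_forall fun _ => Finset.sum_nonneg fun _ _ => dist_nonneg
  rw [eventually_inf_principal]
  filter_upwards with (n, I) hnI
  simp only [← Finset.sum_add_distrib, Finset.mul_sum]
  refine Finset.sum_le_sum fun i hi => ?_
  simp only [disjWithin, mem_ofPred_eq] at hnI
  exact hh _ (hnI.1 i hi).1 _ (hnI.1 i hi).2

theorem absolutelyContinuous_norm {E : Type*} [NormedAddCommGroup E] {f : ℝ → E} {a b : ℝ}
    (hf : AbsolutelyContinuousOnInterval f a b) :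
    AbsolutelyContinuousOnInterval (fun t => ‖f t‖) a b := by
  refine absolutelyContinuous_of_dist_le 1 hf hf fun x _ y _ => ?_
  have h : dist ‖f x‖ ‖f y‖ ≤ dist (f x) (f y) :=
    dist_eq_norm (f x) (f y) ▸ dist_norm_norm_le _ _
  linarith [dist_nonneg (x := f x) (y := f y)]

theorem absolutelyContinuous_comp_of_pos {r g : ℝ → ℝ} {a b : ℝ}
    (hr : AbsolutelyContinuousOnInterval r a b) (hpos : ∀ t ∈ uIcc a b, 0 < r t)
    (hg : ContDiffOn ℝ 1 g (Ioi 0)) :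
    AbsolutelyContinuousOnInterval (fun t => g (r t)) a b := by
  obtain ⟨t₀, ht₀, hmin⟩ := isCompact_uIcc.exists_isMinOn nonempty_uIcc hr.continuousOn
  obtain ⟨t₁, ht₁, hmax⟩ := isCompact_uIcc.exists_isMaxOn nonempty_uIcc hr.continuousOn
  obtain ⟨K, hK⟩ := (hg.mono fun x (hx : x ∈ Icc (r t₀) (r t₁)) =>
    (hpos t₀ ht₀).trans_le hx.1).exists_lipschitzOnWith one_ne_zero (convex_Icc _ _) isCompact_Icc
  refine absolutelyContinuous_of_dist_le K hr hr fun x hx y hy => ?_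
  have h := hK.dist_le_mul (r x) ⟨hmin hx, hmax hx⟩ (r y) ⟨hmin hy, hmax hy⟩
  nlinarith [K.coe_nonneg, dist_nonneg (x := r x) (y := r y)]

theorem le_of_ae_deriv_nonpos {f : ℝ → ℝ} {a b : ℝ} (hab : a ≤ b)
    (hf : AbsolutelyContinuousOnInterval f a b)
    (h : ∀ᵐ t, t ∈ Ioo a b → ∀ d, HasDerivAt f d t → d ≤ 0) : f b ≤ f a := by
  rw [← sub_nonpos, ← hf.integral_deriv_eq_sub, intervalIntegral.integral_of_le hab,
    integral_Ioc_eq_integral_Ioo]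
  refine integral_nonpos_of_ae ?_
  rw [Filter.EventuallyLE, ae_restrict_iff' measurableSet_Ioo]
  filter_upwards [h, hf.ae_differentiableAt] with t h1 h2 ht
  exact h1 ht _ (h2 (uIcc_of_le hab ▸ Ioo_subset_Icc_self ht)).hasDerivAt

/-! ### Trajectories -/

theorem norm_exp_heading (x : ℝ) : ‖Complex.exp (x * Complex.I)‖ = 1 :=
  Complex.norm_exp_ofReal_mul_I x

section Primitive

variable {x u : ℝ → ℂ}

theorem locallyIntegrable_of_norm_le (hu : Measurable u) (hu1 : ∀ t, ‖u t‖ ≤ 1) :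
    LocallyIntegrable u := by
  have h : LocallyIntegrable (fun _ : ℝ => (1 : ℝ)) volume := locallyIntegrable_const _
  exact h.mono hu.aestronglyMeasurable (Filter.Eventually.of_forall fun t => by simpa using hu1 t)

theorem norm_sub_le_of_eq_primitive (hu : Measurable u) (hu1 : ∀ t, ‖u t‖ ≤ 1)
    (hx : ∀ t, 0 ≤ t → x t = x 0 + ∫ s in (0 : ℝ)..t, u s) {s t : ℝ} (hs : 0 ≤ s) (ht : 0 ≤ t) :
    ‖x t - x s‖ ≤ |t - s| := by
  have hi : ∀ a b, IntervalIntegrable u volume a b := fun a b => intervalIntegrable_iff.2 <|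
    ((locallyIntegrable_of_norm_le hu hu1).integrableOn_isCompact isCompact_uIcc).mono_set
      uIoc_subset_uIcc
  rw [hx t ht, hx s hs, add_sub_add_left_eq_sub,
    intervalIntegral.integral_interval_sub_left (hi _ _) (hi _ _)]
  simpa using intervalIntegral.norm_integral_le_of_norm_le_const (a := s) (b := t)
    (fun r _ => hu1 r)

theorem absolutelyContinuous_of_eq_primitive (hu : Measurable u) (hu1 : ∀ t, ‖u t‖ ≤ 1)
    (hx : ∀ t, 0 ≤ t → x t = x 0 + ∫ s in (0 : ℝ)..t, u s) {a b : ℝ} (ha : 0 ≤ a) (hab : a ≤ b) :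
    AbsolutelyContinuousOnInterval x a b := by
  refine LipschitzOnWith.absolutelyContinuousOnInterval (K := 1)
    (LipschitzOnWith.of_dist_le_mul fun t ht s hs => ?_)
  rw [uIcc_of_le hab] at ht hs
  rw [dist_eq_norm, Real.dist_eq, NNReal.coe_one, one_mul]
  exact norm_sub_le_of_eq_primitive hu hu1 hx (ha.trans hs.1) (ha.trans ht.1)

theorem ae_hasDerivAt_of_eq_primitive (hu : Measurable u) (hu1 : ∀ t, ‖u t‖ ≤ 1)
    (hx : ∀ t, 0 ≤ t → x t = x 0 + ∫ s in (0 : ℝ)..t, u s) :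
    ∀ᵐ t, 0 < t → HasDerivAt x (u t) t := by
  filter_upwards [LocallyIntegrable.ae_hasDerivAt_integral
    (locallyIntegrable_of_norm_le hu hu1)] with t h ht
  refine ((h 0).const_add (x 0)).congr_of_eventuallyEq ?_
  filter_upwards [Ioi_mem_nhds ht] with s hs using hx s (le_of_lt hs)

end Primitive

namespace Play

variable {α : ℝ} (p : Play α)

theorem measurable_exp {f : ℝ → ℝ} (hf : Measurable f) :
    Measurable fun t => Complex.exp (f t * Complex.I) := by fun_prop

theorem norm_mul_exp_le (hα0 : 0 ≤ α) (hα1 : α < 1) (x : ℝ) :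
    ‖(α : ℂ) * Complex.exp (x * Complex.I)‖ ≤ 1 := by
  rw [norm_mul, norm_exp_heading, mul_one, Complex.norm_real, Real.norm_of_nonneg hα0]
  exact hα1.le

theorem absolutelyContinuous_state (hα0 : 0 ≤ α) (hα1 : α < 1) {a b : ℝ} (ha : 0 ≤ a)
    (hab : a ≤ b) :
    AbsolutelyContinuousOnInterval (fun t => (p.state t).A) a b ∧
    AbsolutelyContinuousOnInterval (fun t => (p.state t).D) a b ∧
    AbsolutelyContinuousOnInterval (fun t => (p.state t).T) a b :=
  ⟨absolutelyContinuous_of_eq_primitive (measurable_exp p.measurable_χ)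
      (fun _ => (norm_exp_heading _).le) p.motion_A ha hab,
    absolutelyContinuous_of_eq_primitive (measurable_exp p.measurable_ψ)
      (fun _ => (norm_exp_heading _).le) p.motion_D ha hab,
    absolutelyContinuous_of_eq_primitive ((measurable_exp p.measurable_φ).const_mul _)
      (fun _ => norm_mul_exp_le hα0 hα1 _) p.motion_T ha hab⟩

theorem ae_hasDerivAt (hα0 : 0 ≤ α) (hα1 : α < 1) : ∀ᵐ t, 0 < t →
    HasDerivAt (fun t => (p.state t).A) (Complex.exp (p.χ t * Complex.I)) t ∧
    HasDerivAt (fun t => (p.state t).D) (Complex.exp (p.ψ t * Complex.I)) t ∧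
    HasDerivAt (fun t => (p.state t).T) (α * Complex.exp (p.φ t * Complex.I)) t := by
  filter_upwards [ae_hasDerivAt_of_eq_primitive (measurable_exp p.measurable_χ)
      (fun _ => (norm_exp_heading _).le) p.motion_A,
    ae_hasDerivAt_of_eq_primitive (measurable_exp p.measurable_ψ)
      (fun _ => (norm_exp_heading _).le) p.motion_D,
    ae_hasDerivAt_of_eq_primitive ((measurable_exp p.measurable_φ).const_mul _)
      (fun _ => norm_mul_exp_le hα0 hα1 _) p.motion_T] with t h1 h2 h3 ht
  exact ⟨h1 ht, h2 ht, h3 ht⟩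

theorem absolutelyContinuous_dist (hα0 : 0 ≤ α) (hα1 : α < 1) {a b : ℝ} (ha : 0 ≤ a)
    (hab : a ≤ b) :
    AbsolutelyContinuousOnInterval (fun t => ‖(p.state t).A - (p.state t).D‖) a b := by
  obtain ⟨hA, hD, -⟩ := p.absolutelyContinuous_state hα0 hα1 ha hab
  exact absolutelyContinuous_norm (hA.sub hD)

theorem absolutelyContinuous_scaledValue (hα0 : 0 ≤ α) (hα1 : α < 1) {a b : ℝ} (ha : 0 ≤ a)
    (hab : a ≤ b) :
    AbsolutelyContinuousOnInterval (fun t => scaledValue α (p.state t)) a b := by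
  obtain ⟨hA, hD, hT⟩ := p.absolutelyContinuous_state hα0 hα1 ha hab
  have hδ := hA.sub hD
  have hr := p.absolutelyContinuous_dist hα0 hα1 ha hab
  have hr2 : AbsolutelyContinuousOnInterval
      (fun t => ‖(p.state t).A - (p.state t).D‖ ^ 2 / 2) a b := by
    convert (hr.mul hr).const_mul (1 / 2) using 2 with t
    simp only [Pi.mul_apply]
    ring
  have hconj : AbsolutelyContinuousOnInterval
      (fun t => (starRingEnd ℂ) ((p.state t).A - (p.state t).D)) a b := by
    refine absolutelyContinuous_of_dist_le 1 hδ hδ fun x _ y _ => ?_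
    rw [dist_eq_norm, ← map_sub, RCLike.norm_conj, ← dist_eq_norm]
    rw [one_mul]
    exact le_add_of_nonneg_right dist_nonneg
  have hoff : AbsolutelyContinuousOnInterval (fun t => offset (p.state t)) a b := by
    have e : (fun t => offset (p.state t)) =
        fun t => ((p.state t).T - (1 / 2 : ℂ) • ((p.state t).A + (p.state t).D)) •
          (starRingEnd ℂ) ((p.state t).A - (p.state t).D) := by
      funext t
      rw [offset, smul_eq_mul, smul_eq_mul]
      ring
    rw [e]
    exact (hT.sub ((hA.add hD).const_smul (1 / 2 : ℂ))).smul hconj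
  refine absolutelyContinuous_of_dist_le 1 hr2 hoff fun x _ y _ => ?_
  rw [one_mul, Real.dist_eq, Real.dist_eq, dist_eq_norm]
  exact abs_scaledValue_sub_le hα0 hα1 _ _

theorem absolutelyContinuous_value (hα0 : 0 ≤ α) (hα1 : α < 1) {a b : ℝ} (ha : 0 ≤ a)
    (hab : a ≤ b) (h : ∀ t ∈ Icc a b, (p.state t).A ≠ (p.state t).D) :
    AbsolutelyContinuousOnInterval (fun t => value α (p.state t)) a b := by
  have hinv := absolutelyContinuous_comp_of_pos (p.absolutelyContinuous_dist hα0 hα1 ha hab)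
    (fun t ht => norm_pos_iff.2 (sub_ne_zero.2 (h t (uIcc_of_le hab ▸ ht))))
    (g := fun x => x⁻¹) (contDiffOn_id.inv fun x (hx : 0 < x) => hx.ne')
  exact (p.absolutelyContinuous_scaledValue hα0 hα1 ha hab).mul hinv

end Play

/-! ### The derivative of the value along a play -/

theorem re_conj_mul_le_one {e x : ℂ} (he : ‖e‖ = 1) (hx : ‖x‖ = 1) :
    ((starRingEnd ℂ) e * x).re ≤ 1 := by
  refine (Complex.re_le_norm _).trans ?_
  rw [norm_mul, RCLike.norm_conj, he, hx, one_mul]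

theorem eq_of_re_conj_mul_eq_one {e x : ℂ} (he : ‖e‖ = 1) (hx : ‖x‖ = 1)
    (h : ((starRingEnd ℂ) e * x).re = 1) : x = e := by
  have h1 : e.re ^ 2 + e.im ^ 2 = 1 := by
    have := Complex.sq_norm e
    rw [he, Complex.normSq_apply] at this
    linarith
  have h2 : x.re ^ 2 + x.im ^ 2 = 1 := by
    have := Complex.sq_norm x
    rw [hx, Complex.normSq_apply] at this
    linarith
  simp only [Complex.mul_re, Complex.conj_re, Complex.conj_im] at h
  have h3 : (x.re - e.re) ^ 2 + (x.im - e.im) ^ 2 = 0 := by linear_combination h1 + h2 - 2 * h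
  have h4 : x.re - e.re = 0 := by nlinarith [sq_nonneg (x.re - e.re), sq_nonneg (x.im - e.im)]
  have h5 : x.im - e.im = 0 := by nlinarith [sq_nonneg (x.re - e.re), sq_nonneg (x.im - e.im)]
  exact Complex.ext (by linarith) (by linarith)

theorem re_conj_mul_self {e : ℂ} (he : ‖e‖ = 1) : ((starRingEnd ℂ) e * e).re = 1 := by
  rw [mul_comm, Complex.mul_conj, Complex.normSq_eq_norm_sq, he, one_pow, Complex.ofReal_re]

/-- For a fixed direction the payoff is a polynomial in the positions. -/
theorem hasDerivAt_payoff {f : ℝ → GameState} {A' D' T' : ℂ} {t : ℝ} (α q : ℝ)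
    (hA : HasDerivAt (fun t => (f t).A) A' t) (hD : HasDerivAt (fun t => (f t).D) D' t)
    (hT : HasDerivAt (fun t => (f t).T) T' t) :
    HasDerivAt (fun t => payoff α q (f t))
      (α * √(1 - q ^ 2) * ((starRingEnd ℂ) ((f t).A - (f t).D) * (A' - D')).re -
        √(1 - α ^ 2 * q ^ 2) * ((T' - (A' + D') / 2) * (starRingEnd ℂ) ((f t).A - (f t).D) +
          ((f t).T - ((f t).A + (f t).D) / 2) * (starRingEnd ℂ) (A' - D')).re +
        α * q * ((T' - (A' + D') / 2) * (starRingEnd ℂ) ((f t).A - (f t).D) +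
          ((f t).T - ((f t).A + (f t).D) / 2) * (starRingEnd ℂ) (A' - D')).im) t := by
  have hδ := hA.fun_sub hD
  have h1 : HasDerivAt (fun t => ‖(f t).A - (f t).D‖ ^ 2 / 2)
      (((starRingEnd ℂ) ((f t).A - (f t).D) * (A' - D')).re) t := by
    refine (hδ.norm_sq.div_const 2).congr_deriv ?_
    rw [Complex.inner, mul_comm (A' - D')]
    ring
  have hoff : HasDerivAt (fun t => offset (f t))
      ((T' - (A' + D') / 2) * (starRingEnd ℂ) ((f t).A - (f t).D) +
          ((f t).T - ((f t).A + (f t).D) / 2) * (starRingEnd ℂ) (A' - D')) t :=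
    (hT.fun_sub ((hA.fun_add hD).div_const 2)).fun_mul hδ.star
  have hre := Complex.reCLM.hasFDerivAt.comp_hasDerivAt t hoff
  have him := Complex.imCLM.hasFDerivAt.comp_hasDerivAt t hoff
  exact ((h1.const_mul _).sub (hre.const_mul _)).add (him.const_mul _)

namespace Aim

variable {α : ℝ} {s : GameState} (m : Aim α s)

theorem κ_sub_lower (hα0 : 0 ≤ α) (hα1 : α < 1) : (1 - α ^ 2) / 2 ≤ m.κ - α * m.c := by
  have hκ := m.κ_pos
  have hc := m.c_pos
  have h1 : (m.κ - α * m.c) * (m.κ + α * m.c) = 1 - α ^ 2 := by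
    linear_combination m.κ_sq - α ^ 2 * m.c_sq
  have h2 : m.κ ≤ 1 := by nlinarith [m.κ_sq, sq_nonneg (α * m.q)]
  have h3 : α * m.c ≤ 1 := mul_le_one₀ hα1.le hc.le (by nlinarith [m.c_sq, sq_nonneg m.q])
  have h4 : 0 < m.κ + α * m.c := by positivity
  have h5 : 0 < 1 - α ^ 2 := by nlinarith
  have h6 : 0 < m.κ - α * m.c := pos_of_mul_pos_left (h1 ▸ h5) h4.le
  nlinarith

/-- The derivative of the value when the attacker, the defender and the target move in the
directions `x`, `y`, `z`: the Hamiltonian of the game, with the gradient of the value expressed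
through the optimal directions. -/
def rate (x y z : ℂ) : ℝ :=
  α * (((starRingEnd ℂ) m.dirT * z).re - 1) +
    (m.κ + α * m.c) / (2 * m.c) * (1 - ((starRingEnd ℂ) m.dirA * x).re) -
    (m.κ - α * m.c) / (2 * m.c) * (1 - ((starRingEnd ℂ) m.dirD * y).re)

theorem conj_a_mul (x : ℂ) : (starRingEnd ℂ) m.a * (m.a * x) = x := by
  have : m.a * (starRingEnd ℂ) m.a = 1 := by
    rw [Complex.mul_conj, Complex.normSq_eq_norm_sq, m.norm_a]; simp
  rw [← mul_assoc, mul_comm _ m.a, this, one_mul]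

theorem conj_mul_a_mul (w x : ℂ) :
    (starRingEnd ℂ) (m.a * w) * (m.a * x) = (starRingEnd ℂ) w * x := by
  rw [map_mul, mul_right_comm, m.conj_a_mul, mul_comm]

/-- The derivative of the distance of `A` and `D`. -/
theorem hasDerivAt_dist {f : ℝ → GameState} {x y : ℂ} {t : ℝ} (m : Aim α (f t))
    (hA : HasDerivAt (fun t => (f t).A) x t) (hD : HasDerivAt (fun t => (f t).D) y t) :
    HasDerivAt (fun t => ‖(f t).A - (f t).D‖) ((starRingEnd ℂ) m.a * (x - y)).re t := by
  have hτ := m.τ_pos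
  have hc := m.c_pos
  have hδ := (hA.fun_sub hD).norm_sq
  have h0 : ‖(f t).A - (f t).D‖ ^ 2 ≠ 0 := by rw [m.norm_sub]; positivity
  have h := hδ.sqrt h0
  simp only [Real.sqrt_sq (norm_nonneg _)] at h
  convert h using 1
  rw [Complex.inner, m.norm_sub, m.sub_eq, map_mul, Complex.conj_ofReal,
    ← mul_assoc, Complex.re_mul_ofReal, mul_comm (x - y)]
  field_simp

/-- The envelope theorem: the value is the maximum of the payoffs divided by the distance of `A`
and `D`, and only the maximizing direction contributes to its derivative. -/
theorem hasDerivAt_value (hα0 : 0 ≤ α) (hα1 : α < 1) {f : ℝ → GameState} {x y z : ℂ} {t : ℝ}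
    (m : Aim α (f t)) (hA : HasDerivAt (fun t => (f t).A) x t)
    (hD : HasDerivAt (fun t => (f t).D) y t) (hT : HasDerivAt (fun t => (f t).T) (α * z) t)
    (hW : DifferentiableAt ℝ (fun t => scaledValue α (f t)) t) :
    HasDerivAt (fun t => value α (f t)) (m.rate x y z) t := by
  have hτ := m.τ_pos
  have hc := m.c_pos
  have hP := hasDerivAt_payoff α m.q hA hD hT
  have hmin : IsLocalMin (fun t => scaledValue α (f t) - payoff α m.q (f t)) t := by
    refine Filter.Eventually.of_forall fun r => ?_
    simp only [m.scaledValue_eq hα0 hα1, m.payoff_q, sub_self]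
    exact sub_nonneg.2 (payoff_le_scaledValue hα0 hα1 m.q_mem _)
  have heq := sub_eq_zero.1 (hmin.hasDerivAt_eq_zero (hW.hasDerivAt.fun_sub hP))
  have hW' := hW.hasDerivAt
  rw [heq, m.sqrt_one_sub, m.sqrt_one_sub', m.sub_eq, m.target_eq] at hW'
  have hne : ‖(f t).A - (f t).D‖ ≠ 0 := by rw [m.norm_sub]; positivity
  have hV := hW'.fun_div (m.hasDerivAt_dist hA hD) hne
  refine hV.congr_deriv ?_
  rw [m.norm_sub, m.scaledValue_eq hα0 hα1]
  obtain ⟨x, rfl⟩ : ∃ x', x = m.a * x' := ⟨x / m.a, by rw [mul_div_cancel₀ _ m.a_ne_zero]⟩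
  obtain ⟨y, rfl⟩ : ∃ x', y = m.a * x' := ⟨y / m.a, by rw [mul_div_cancel₀ _ m.a_ne_zero]⟩
  obtain ⟨z, rfl⟩ : ∃ x', z = m.a * x' := ⟨z / m.a, by rw [mul_div_cancel₀ _ m.a_ne_zero]⟩
  rw [rate, dirA, dirD, dirT, ← mul_sub, m.conj_mul_a_mul, m.conj_mul_a_mul, m.conj_mul_a_mul,
    m.conj_mul_a_mul, m.conj_a_mul,
    show (α : ℂ) * (m.a * z) - (m.a * x + m.a * y) / 2 = m.a * (α * z - (x + y) / 2) by ring,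
    mul_comm (m.a * (α * z - (x + y) / 2)), m.conj_mul_a_mul,
    mul_comm (m.a * (⟨_, _⟩ : ℂ)), m.conj_mul_a_mul]
  simp only [Complex.mul_re, Complex.mul_im, Complex.conj_re, Complex.conj_im, Complex.add_re,
    Complex.add_im, Complex.sub_re, Complex.sub_im, Complex.ofReal_re, Complex.ofReal_im,
    Complex.div_ofNat_re, Complex.div_ofNat_im]
  field_simp
  linear_combination 2 * (x.re - y.re) * (m.σ * m.κ_sq + α * m.τ * m.c_sq)

end Aim

namespace Play

variable {α : ℝ} (p : Play α)

/-- Almost everywhere on an interval in the escape region, the value has the derivative given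
by `Aim.rate`. -/
theorem ae_hasDerivAt_value (hα0 : 0 ≤ α) (hα1 : α < 1) {b : ℝ} (hb : 0 ≤ b) :
    ∀ᵐ t, t ∈ Ioo 0 b → ∀ m : Aim α (p.state t),
      HasDerivAt (fun t => value α (p.state t))
        (m.rate (Complex.exp (p.χ t * Complex.I)) (Complex.exp (p.ψ t * Complex.I))
          (Complex.exp (p.φ t * Complex.I))) t ∧
      HasDerivAt (fun t => ‖(p.state t).A - (p.state t).D‖)
        ((starRingEnd ℂ) m.a * (Complex.exp (p.χ t * Complex.I) -
          Complex.exp (p.ψ t * Complex.I))).re t := by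
  filter_upwards [p.ae_hasDerivAt hα0 hα1,
    (p.absolutelyContinuous_scaledValue hα0 hα1 le_rfl hb).ae_differentiableAt] with t h1 h2 ht m
  obtain ⟨hA, hD, hT⟩ := h1 ht.1
  exact ⟨m.hasDerivAt_value hα0 hα1 hA hD hT
    (h2 (by rw [uIcc_of_le hb]; exact Ioo_subset_Icc_self ht)), m.hasDerivAt_dist hA hD⟩

end Play

/-! ### Optimal play -/

namespace Aim

variable {α : ℝ} {s : GameState} (m : Aim α s)

/-- The state after all players have used their laws for the time `t`. -/
def flow (t : ℝ) : GameState :=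
  ⟨s.A + t * m.dirA, s.D + t * m.dirD, s.T + t * (α * m.dirT)⟩

/-- Along optimal play the players move on straight lines and the aimpoint does not change. -/
def aimFlow {t : ℝ} (ht : t ∈ Ico 0 m.τ) : Aim α (m.flow t) where
  a := m.a
  q := m.q
  c := m.c
  κ := m.κ
  τ := m.τ - t
  σ := m.σ + α * t
  norm_a := m.norm_a
  c_pos := m.c_pos
  c_sq := m.c_sq
  κ_pos := m.κ_pos
  κ_sq := m.κ_sq
  τ_pos := sub_pos.2 ht.2
  payoff_pos := by linarith [m.payoff_pos]
  sub_eq := by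
    have h : (m.flow t).A - (m.flow t).D = (s.A - s.D) + t * (m.dirA - m.dirD) := by
      simp only [flow]; ring
    rw [h, m.sub_eq, dirA, dirD, ← mul_sub, mul_left_comm, ← mul_add]
    congr 1
    apply Complex.ext
    · simp; ring
    · simp
  target_eq := by
    have h : (m.flow t).T - ((m.flow t).A + (m.flow t).D) / 2 =
        (s.T - (s.A + s.D) / 2) + t * (α * m.dirT - (m.dirA + m.dirD) / 2) := by
      simp only [flow]; ring
    rw [h, m.target_eq, dirA, dirD, dirT, ← mul_add m.a, mul_div_assoc m.a, mul_left_comm (α : ℂ),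
      ← mul_sub, mul_left_comm (t : ℂ), ← mul_add]
    congr 1
    apply Complex.ext
    · simp; ring
    · simp; ring

theorem exp_arg_mul_I {z : ℂ} (hz : ‖z‖ = 1) : Complex.exp (z.arg * Complex.I) = z := by
  have := Complex.norm_mul_exp_arg_mul_I z
  rwa [hz, Complex.ofReal_one, one_mul] at this

/-- The play in which all players use their laws. -/
def optimalPlay : Play α where
  χ := fun _ => m.dirA.arg
  ψ := fun _ => m.dirD.arg
  φ := fun _ => m.dirT.arg
  state := m.flow
  measurable_χ := measurable_const
  measurable_ψ := measurable_const
  measurable_φ := measurable_const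
  χ_mem := fun _ => ⟨(Complex.neg_pi_lt_arg _).le, Complex.arg_le_pi _⟩
  ψ_mem := fun _ => ⟨(Complex.neg_pi_lt_arg _).le, Complex.arg_le_pi _⟩
  φ_mem := fun _ => ⟨(Complex.neg_pi_lt_arg _).le, Complex.arg_le_pi _⟩
  motion_A := fun t _ => by simp [flow, exp_arg_mul_I m.norm_dirA]
  motion_D := fun t _ => by simp [flow, exp_arg_mul_I m.norm_dirD]
  motion_T := fun t _ => by
    simp [flow, exp_arg_mul_I m.norm_dirT, mul_left_comm]

theorem flow_zero : m.flow 0 = s := by simp [flow]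

include m in
theorem exists_optimal_play (hα0 : 0 ≤ α) (hα1 : α < 1) :
    ∃ (p : Play α) (τ : ℝ), p.state 0 = s ∧ 0 < τ ∧ p.Running τ ∧
      (∀ t ∈ Ico 0 τ, p.state t ∈ escapeRegion α) ∧ p.AttackerFollows τ ∧ p.TeamFollows τ ∧
      (p.state τ).A = (p.state τ).D ∧ p.NonTangential τ ∧ p.cost τ = value α s ^ 2 / 2 := by
  have hc := m.c_pos
  have hτ := m.τ_pos
  have hmem : ∀ t ∈ Ico 0 m.τ, m.flow t ∈ escapeRegion α := fun t ht =>
    (m.aimFlow ht).mem_escapeRegion hα0 hα1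
  have hmeet : (m.flow m.τ).A = (m.flow m.τ).D := by
    rw [← sub_eq_zero]
    have h : (m.flow m.τ).A - (m.flow m.τ).D = (s.A - s.D) + m.τ * (m.dirA - m.dirD) := by
      simp only [flow]; ring
    rw [h, m.sub_eq, dirA, dirD, ← mul_sub, mul_left_comm, ← mul_add]
    refine mul_eq_zero_of_right _ (Complex.ext ?_ ?_)
    · simp; ring
    · simp
  refine ⟨m.optimalPlay, m.τ, m.flow_zero, hτ, fun t ht => ⟨(hmem t ht).1, ?_⟩, hmem,
    fun t ht hs => ?_, fun t ht hs => ⟨?_, ?_⟩, hmeet, ⟨2 * m.c, by positivity, fun t ht => ?_⟩, ?_⟩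
  · have h := value_le_norm_sub hα0 hα1 (hmem t ht).1
    have h' := value_pos hα0 hα1 (hmem t ht)
    exact sub_ne_zero.1 (norm_pos_iff.1 (h'.trans_le h))
  · exact ((m.aimFlow ht).attackerLaw_iff hα0 hα1 hs).2 (exp_arg_mul_I m.norm_dirA)
  · exact ((m.aimFlow ht).defenderLaw_iff hα0 hα1 hs).2 (exp_arg_mul_I m.norm_dirD)
  · exact ((m.aimFlow ht).targetLaw_iff hα0 hα1 hs).2 (exp_arg_mul_I m.norm_dirT)
  · rcases ht.2.lt_or_eq with h | h
    · have := (m.aimFlow ⟨ht.1, h⟩).norm_sub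
      change _ ≤ ‖(m.flow t).A - (m.flow t).D‖
      rw [this]
      simp only [aimFlow]
      linarith
    · rw [h, sub_self, mul_zero]
      exact norm_nonneg _
  · have h : (m.flow m.τ).A - (m.flow m.τ).T = ((-(α * m.τ + m.σ) : ℝ) : ℂ) * m.dirT := by
      have : (m.flow m.τ).A - (m.flow m.τ).T =
          (s.A - s.T) + m.τ * (m.dirA - α * m.dirT) := by
        simp only [flow]; ring
      rw [this, m.sub_target_eq]
      push_cast
      ring
    change ‖(m.flow m.τ).A - (m.flow m.τ).T‖ ^ 2 / 2 = _
    rw [h, norm_mul, m.norm_dirT, mul_one, Complex.norm_real, Real.norm_eq_abs, sq_abs, neg_sq,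
      m.value_eq hα0 hα1]

end Aim

/-! ### What target and defender guarantee -/

namespace Aim

variable {α : ℝ} {s : GameState} (m : Aim α s)

theorem rate_team (x : ℂ) : m.rate x m.dirD m.dirT =
    (m.κ + α * m.c) / (2 * m.c) * (1 - ((starRingEnd ℂ) m.dirA * x).re) := by
  rw [rate, re_conj_mul_self m.norm_dirD, re_conj_mul_self m.norm_dirT]
  ring

theorem rate_attacker (y z : ℂ) : m.rate m.dirA y z =
    -(α * (1 - ((starRingEnd ℂ) m.dirT * z).re) +
      (m.κ - α * m.c) / (2 * m.c) * (1 - ((starRingEnd ℂ) m.dirD * y).re)) := by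
  rw [rate, re_conj_mul_self m.norm_dirA]
  ring

theorem rate_team_nonneg (hα0 : 0 ≤ α) {x : ℂ} (hx : ‖x‖ = 1) :
    0 ≤ m.rate x m.dirD m.dirT := by
  have := m.c_pos
  have := m.κ_pos
  rw [rate_team]
  exact mul_nonneg (by positivity) (sub_nonneg.2 (re_conj_mul_le_one m.norm_dirA hx))

theorem κ_sub_pos (hα0 : 0 ≤ α) (hα1 : α < 1) : 0 < m.κ - α * m.c := by
  have : 0 < 1 - α ^ 2 := by nlinarith
  linarith [m.κ_sub_lower hα0 hα1]

theorem rate_attacker_nonpos (hα0 : 0 ≤ α) (hα1 : α < 1) {y z : ℂ} (hy : ‖y‖ = 1)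
    (hz : ‖z‖ = 1) : m.rate m.dirA y z ≤ 0 := by
  have hc := m.c_pos
  have h := m.κ_sub_pos hα0 hα1
  rw [rate_attacker, neg_nonpos]
  exact add_nonneg (mul_nonneg hα0 (sub_nonneg.2 (re_conj_mul_le_one m.norm_dirT hz)))
    (mul_nonneg (by positivity) (sub_nonneg.2 (re_conj_mul_le_one m.norm_dirD hy)))

theorem eq_dirA_of_rate_eq_zero (hα0 : 0 ≤ α) {x : ℂ} (hx : ‖x‖ = 1)
    (h : m.rate x m.dirD m.dirT = 0) : x = m.dirA := by
  have := m.c_pos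
  have := m.κ_pos
  rw [rate_team] at h
  have := (mul_eq_zero.1 h).resolve_left (by positivity)
  exact eq_of_re_conj_mul_eq_one m.norm_dirA hx (by linarith)

theorem eq_dir_of_rate_eq_zero (hα0 : 0 ≤ α) (hα1 : α < 1) {y z : ℂ} (hy : ‖y‖ = 1)
    (hz : ‖z‖ = 1) (h : m.rate m.dirA y z = 0) : y = m.dirD ∧ (0 < α → z = m.dirT) := by
  have hc := m.c_pos
  have hk := m.κ_sub_pos hα0 hα1
  have h1 : 0 ≤ α * (1 - ((starRingEnd ℂ) m.dirT * z).re) :=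
    mul_nonneg hα0 (sub_nonneg.2 (re_conj_mul_le_one m.norm_dirT hz))
  have h2 : 0 ≤ (m.κ - α * m.c) / (2 * m.c) * (1 - ((starRingEnd ℂ) m.dirD * y).re) :=
    mul_nonneg (by positivity) (sub_nonneg.2 (re_conj_mul_le_one m.norm_dirD hy))
  rw [rate_attacker] at h
  have h3 : (m.κ - α * m.c) / (2 * m.c) * (1 - ((starRingEnd ℂ) m.dirD * y).re) = 0 := by linarith
  have h4 : α * (1 - ((starRingEnd ℂ) m.dirT * z).re) = 0 := by linarith
  refine ⟨?_, fun hα => ?_⟩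
  · have := (mul_eq_zero.1 h3).resolve_left (by positivity)
    exact eq_of_re_conj_mul_eq_one m.norm_dirD hy (by linarith)
  · have := (mul_eq_zero.1 h4).resolve_left hα.ne'
    exact eq_of_re_conj_mul_eq_one m.norm_dirT hz (by linarith)

end Aim

/-- Inequalities that hold before the end pass to the end. -/
theorem le_right_of_forall_le {g : ℝ → ℝ} {a b K : ℝ} (hg : ContinuousOn g (Icc a b))
    (hab : a < b) (h : ∀ t ∈ Ico a b, K ≤ g t) : K ≤ g b := by
  have ht : Filter.Tendsto g (nhdsWithin b (Iio b)) (nhds (g b)) :=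
    ((hg b (right_mem_Icc.2 hab.le)).mono_of_mem_nhdsWithin
      (Filter.mem_of_superset (Ioo_mem_nhdsLT hab) Ioo_subset_Icc_self))
  refine ge_of_tendsto ht ?_
  filter_upwards [Ioo_mem_nhdsLT hab] with t ht using h t ⟨ht.1.le, ht.2⟩

namespace Play

variable {α : ℝ} (p : Play α)

theorem continuousOn_norm_sub (hα0 : 0 ≤ α) (hα1 : α < 1) {a b : ℝ} (ha : 0 ≤ a) (hab : a ≤ b) :
    ContinuousOn (fun t => ‖(p.state t).A - (p.state t).T‖) (Icc a b) := by
  obtain ⟨hA, -, hT⟩ := p.absolutelyContinuous_state hα0 hα1 ha hab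
  have := (hA.continuousOn.sub hT.continuousOn).norm
  rwa [uIcc_of_le hab] at this

theorem continuousOn_value (hα0 : 0 ≤ α) (hα1 : α < 1) {a b : ℝ} (ha : 0 ≤ a) (hab : a ≤ b)
    (h : ∀ t ∈ Icc a b, (p.state t).A ≠ (p.state t).D) :
    ContinuousOn (fun t => value α (p.state t)) (Icc a b) :=
  uIcc_of_le hab ▸ (p.absolutelyContinuous_value hα0 hα1 ha hab h).continuousOn

theorem value_le_of_teamFollows (hα0 : 0 ≤ α) (hα1 : α < 1) {a b τ : ℝ} (ha : 0 ≤ a)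
    (hab : a ≤ b) (hb : b < τ) (h : ∀ t ∈ Icc a b, p.state t ∈ escapeRegion α)
    (hp : p.TeamFollows τ) : value α (p.state a) ≤ value α (p.state b) := by
  have hac := (p.absolutelyContinuous_value hα0 hα1 ha hab fun t ht => (h t ht).1).neg
  refine neg_le_neg_iff.1 (le_of_ae_deriv_nonpos (f := -fun t => value α (p.state t)) hab hac ?_)
  filter_upwards [p.ae_hasDerivAt_value hα0 hα1 (ha.trans hab)] with t h1 ht d hd
  have hs := h t (Ioo_subset_Icc_self ht)
  obtain ⟨m⟩ := exists_aim hα0 hα1 hs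
  obtain ⟨hD, hT⟩ := hp t ⟨ha.trans ht.1.le, ht.2.trans hb⟩ hs
  have h2 := (h1 ⟨ha.trans_lt ht.1, ht.2⟩ m).1
  rw [(m.defenderLaw_iff hα0 hα1 hs).1 hD, (m.targetLaw_iff hα0 hα1 hs).1 hT] at h2
  rw [hd.unique h2.neg, neg_nonpos]
  exact m.rate_team_nonneg hα0 (norm_exp_heading _)

/-- The target stays safe: the value cannot decrease while it is positive, hence it stays
positive, and its positivity characterizes the escape region. -/
theorem mem_escapeRegion_of_teamFollows (hα0 : 0 ≤ α) (hα1 : α < 1) {τ : ℝ}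
    (h0 : p.state 0 ∈ escapeRegion α) (hne : ∀ t ∈ Ico 0 τ, (p.state t).A ≠ (p.state t).D)
    (hp : p.TeamFollows τ) {t : ℝ} (ht : t ∈ Ico 0 τ) :
    p.state t ∈ escapeRegion α ∧ value α (p.state 0) ≤ value α (p.state t) := by
  have hpos := value_pos hα0 hα1 h0
  have hcont := p.continuousOn_value hα0 hα1 le_rfl ht.1
    fun r hr => hne r ⟨hr.1, hr.2.trans_lt ht.2⟩
  have hsub : Icc 0 t ⊆ {r | value α (p.state 0) ≤ value α (p.state r)} := by
    refine IsClosed.Icc_subset_of_forall_mem_nhdsWithin ?_ ?_ ?_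
    · rw [inter_comm]
      exact hcont.preimage_isClosed_of_isClosed isClosed_Icc isClosed_Ici
    · exact le_refl (value α (p.state 0))
    · rintro r ⟨hr, hr0, hrt⟩
      have hr' : value α (p.state 0) ≤ value α (p.state r) := hr
      have hev : ∀ᶠ u in nhdsWithin r (Icc 0 t), 0 < value α (p.state u) :=
        (hcont r ⟨hr0, hrt.le⟩).eventually (Ioi_mem_nhds (hpos.trans_le hr'))
      obtain ⟨ε, hε, hball⟩ := Metric.mem_nhdsWithin_iff.1 hev
      have hlt : r < min t (r + ε) := lt_min hrt (by linarith)
      filter_upwards [Ioo_mem_nhdsGT hlt] with u hu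
      have hut := hu.2.trans_le (min_le_left _ _)
      have huε := hu.2.trans_le (min_le_right _ _)
      refine hr'.trans (p.value_le_of_teamFollows hα0 hα1 hr0 hu.1.le (hut.trans ht.2)
        (fun v hv => ?_) hp)
      refine mem_escapeRegion_of_value_pos hα0 hα1
        (hne v ⟨hr0.trans hv.1, hv.2.trans_lt (hut.trans ht.2)⟩) (hball ⟨?_, ?_⟩)
      · rw [Metric.mem_ball, Real.dist_eq, abs_of_nonneg (by linarith [hv.1])]
        linarith [hv.2]
      · exact ⟨hr0.trans hv.1, hv.2.trans hut.le⟩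
  have hle : value α (p.state 0) ≤ value α (p.state t) := hsub ⟨ht.1, le_rfl⟩
  exact ⟨mem_escapeRegion_of_value_pos hα0 hα1 (hne t ht) (hpos.trans_le hle), hle⟩

/-- If the value is constant along a play, then its derivative vanishes. -/
theorem ae_rate_eq_zero (hα0 : 0 ≤ α) (hα1 : α < 1) {τ K : ℝ} (hτ : 0 < τ)
    (h : ∀ t ∈ Ico 0 τ, value α (p.state t) = K) :
    ∀ᵐ t ∂(volume.restrict (Ico 0 τ)), t ∈ Ico 0 τ ∧ ∀ m : Aim α (p.state t),
      m.rate (Complex.exp (p.χ t * Complex.I)) (Complex.exp (p.ψ t * Complex.I))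
        (Complex.exp (p.φ t * Complex.I)) = 0 := by
  rw [← restrict_Ioo_eq_restrict_Ico, ae_restrict_iff' measurableSet_Ioo]
  filter_upwards [p.ae_hasDerivAt_value hα0 hα1 hτ.le] with t h1 ht
  refine ⟨Ioo_subset_Ico_self ht, fun m => (h1 ht m).1.unique ?_⟩
  refine (hasDerivAt_const t K).congr_of_eventuallyEq ?_
  filter_upwards [Ioo_mem_nhds ht.1 ht.2] with r hr using h r (Ioo_subset_Ico_self hr)

theorem team_guarantee (hα0 : 0 ≤ α) (hα1 : α < 1) {τ : ℝ} (hτ : 0 < τ)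
    (h0 : p.state 0 ∈ escapeRegion α) (hne : ∀ t ∈ Ico 0 τ, (p.state t).A ≠ (p.state t).D)
    (hp : p.TeamFollows τ) :
    value α (p.state 0) ≤ ‖(p.state τ).A - (p.state τ).T‖ ∧
      (‖(p.state τ).A - (p.state τ).T‖ = value α (p.state 0) →
        ∀ᵐ t ∂(volume.restrict (Ico 0 τ)), AttackerLaw α (p.state t) (p.χ t)) := by
  have hmem := fun t ht => p.mem_escapeRegion_of_teamFollows hα0 hα1 h0 hne hp (t := t) ht
  have hlim : ∀ a ∈ Ico 0 τ, value α (p.state a) ≤ ‖(p.state τ).A - (p.state τ).T‖ := by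
    intro a ha
    refine le_right_of_forall_le
      (g := fun t => ‖(p.state t).A - (p.state t).T‖)
      (p.continuousOn_norm_sub hα0 hα1 ha.1 ha.2.le) ha.2
      fun t ht => ?_
    have ht' : t ∈ Ico 0 τ := ⟨ha.1.trans ht.1, ht.2⟩
    exact (p.value_le_of_teamFollows hα0 hα1 ha.1 ht.1 ht.2
      (fun r hr => (hmem r ⟨ha.1.trans hr.1, hr.2.trans_lt ht.2⟩).1) hp).trans
        (value_le_norm_sub hα0 hα1 (hne t ht'))
  refine ⟨hlim 0 ⟨le_rfl, hτ⟩, fun heq => ?_⟩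
  have hconst : ∀ t ∈ Ico 0 τ, value α (p.state t) = value α (p.state 0) := fun t ht =>
    le_antisymm (heq ▸ hlim t ht) (hmem t ht).2
  filter_upwards [p.ae_rate_eq_zero hα0 hα1 hτ hconst] with t ⟨ht, h⟩
  have hs := (hmem t ht).1
  obtain ⟨m⟩ := exists_aim hα0 hα1 hs
  obtain ⟨hD, hT⟩ := hp t ht hs
  have h' := h m
  rw [(m.defenderLaw_iff hα0 hα1 hs).1 hD, (m.targetLaw_iff hα0 hα1 hs).1 hT] at h'
  exact (m.attackerLaw_iff hα0 hα1 hs).2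
    (m.eq_dirA_of_rate_eq_zero hα0 (norm_exp_heading _) h')

end Play

/-! ### What the attacker guarantees -/

namespace Aim

variable {α : ℝ} {s : GameState} (m : Aim α s)

/-- While the time to go is at least `b`, a defender who runs towards the attacker instead of the
aimpoint loses value at a rate inversely proportional to the distance of `A` and `D`. -/
theorem rate_attacker_le (hα0 : 0 ≤ α) (hα1 : α < 1) {b ε : ℝ} (hb : 0 < b) (hbτ : b ≤ m.τ)
    (hε : 0 < ε) {y z : ℂ} (hy : ‖y‖ = 1) (hz : ‖z‖ = 1) :
    m.rate m.dirA y z ≤ (1 - α ^ 2) / 2 * b * ε *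
      (((starRingEnd ℂ) m.a * (m.dirA - y)).re / ‖s.A - s.D‖ + ε / (2 * ‖s.A - s.D‖)) +
      (1 - α ^ 2) / 2 * (1 + ε) / 2 := by
  have hc := m.c_pos
  have hτ := m.τ_pos
  have hM : 0 < (1 - α ^ 2) / 2 := by nlinarith
  have hκ := m.κ_sub_lower hα0 hα1
  set M := (1 - α ^ 2) / 2
  rw [m.norm_sub]
  have hg0 := re_conj_mul_le_one m.norm_dirD hy
  have hT0 := mul_nonneg hα0 (sub_nonneg.2 (re_conj_mul_le_one m.norm_dirT hz))
  rw [rate_attacker]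
  obtain ⟨w, rfl⟩ : ∃ w, y = m.a * w := ⟨y / m.a, by rw [mul_div_cancel₀ _ m.a_ne_zero]⟩
  rw [norm_mul, m.norm_a, one_mul] at hy
  have hw : w.re ^ 2 + w.im ^ 2 = 1 := by
    have := Complex.sq_norm w
    rw [hy, Complex.normSq_apply] at this
    linarith
  rw [dirD, m.conj_mul_a_mul] at hg0 ⊢
  rw [dirA, ← mul_sub, m.conj_a_mul]
  have hge : ε * w.re - m.c - ε ^ 2 / 2 ≤ 1 - ((starRingEnd ℂ) (⟨m.c, m.q⟩ : ℂ) * w).re := by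
    simp only [Complex.mul_re, Complex.conj_re, Complex.conj_im]
    have h1 : w.re ≤ 1 := by nlinarith [sq_nonneg w.im]
    have h2 : m.c * w.re ≤ m.c * 1 := by gcongr
    have hq : |m.q| ≤ 1 := abs_le.2 m.q_mem
    have h3 : m.q * w.im ≤ |w.im| := by
      refine (le_abs_self _).trans ?_
      rw [abs_mul]
      exact mul_le_of_le_one_left (abs_nonneg _) hq
    -- `|sin| ≤ 1 - cos ^ 2 / 2`, and then `cos ^ 2 ≥ 2 ε cos - ε ^ 2`
    have h4 : |w.im| ≤ 1 - w.re ^ 2 / 2 := by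
      have := sq_abs w.im
      nlinarith [sq_nonneg (1 - |w.im|)]
    nlinarith [sq_nonneg (w.re - ε)]
  have hX : M * b / (2 * m.τ * m.c) * (1 - ((starRingEnd ℂ) (⟨m.c, m.q⟩ : ℂ) * w).re) ≤
      (m.κ - α * m.c) / (2 * m.c) * (1 - ((starRingEnd ℂ) (⟨m.c, m.q⟩ : ℂ) * w).re) := by
    refine mul_le_mul_of_nonneg_right ?_ (sub_nonneg.2 hg0)
    rw [div_le_div_iff₀ (by positivity) (by positivity)]
    have : M * b ≤ (m.κ - α * m.c) * m.τ := mul_le_mul hκ hbτ hb.le (hM.le.trans hκ)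
    nlinarith
  have hY : M * b / (2 * m.τ * m.c) * (ε * w.re - m.c - ε ^ 2 / 2) ≤
      M * b / (2 * m.τ * m.c) * (1 - ((starRingEnd ℂ) (⟨m.c, m.q⟩ : ℂ) * w).re) :=
    mul_le_mul_of_nonneg_left hge (by positivity)
  have hZ : M * (1 + ε) * (b / (2 * m.τ)) ≤ M * (1 + ε) * (1 / 2) := by
    refine mul_le_mul_of_nonneg_left ?_ (by positivity)
    rw [div_le_div_iff₀ (by positivity) (by positivity)]
    linarith
  have e : M * b * ε * (((⟨-m.c, m.q⟩ : ℂ) - w).re / (2 * m.τ * m.c) + ε / (2 * (2 * m.τ * m.c))) =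
      -(M * b / (2 * m.τ * m.c) * (ε * w.re - m.c - ε ^ 2 / 2)) -
        M * (1 + ε) * (b / (2 * m.τ)) := by
    rw [Complex.sub_re]
    field_simp
    ring
  rw [e]
  linarith

end Aim

namespace Play

variable {α : ℝ} (p : Play α)

theorem value_le_of_attackerFollows (hα0 : 0 ≤ α) (hα1 : α < 1) {a b τ : ℝ} (ha : 0 ≤ a)
    (hab : a ≤ b) (hb : b < τ) (h : ∀ t ∈ Ico 0 τ, p.state t ∈ escapeRegion α)
    (hp : p.AttackerFollows τ) : value α (p.state b) ≤ value α (p.state a) := by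
  have hIcc : ∀ t ∈ Icc a b, t ∈ Ico 0 τ := fun t ht => ⟨ha.trans ht.1, ht.2.trans_lt hb⟩
  refine le_of_ae_deriv_nonpos (f := fun t => value α (p.state t)) hab
    (p.absolutelyContinuous_value hα0 hα1 ha hab fun t ht => (h t (hIcc t ht)).1) ?_
  filter_upwards [p.ae_hasDerivAt_value hα0 hα1 (ha.trans hab)] with t h1 ht d hd
  have ht' := hIcc t (Ioo_subset_Icc_self ht)
  have hs := h t ht'
  obtain ⟨m⟩ := exists_aim hα0 hα1 hs
  have h2 := (h1 ⟨ha.trans_lt ht.1, ht.2⟩ m).1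
  rw [(m.attackerLaw_iff hα0 hα1 hs).1 (hp t ht' hs)] at h2
  rw [hd.unique h2]
  exact m.rate_attacker_nonpos hα0 hα1 (norm_exp_heading _) (norm_exp_heading _)

theorem dist_le_two_mul {t τ : ℝ} (ht : 0 ≤ t) (htτ : t ≤ τ)
    (h : (p.state τ).A = (p.state τ).D) :
    ‖(p.state t).A - (p.state t).D‖ ≤ 2 * (τ - t) := by
  have hA := norm_sub_le_of_eq_primitive (measurable_exp p.measurable_χ)
    (fun _ => (norm_exp_heading _).le) p.motion_A ht (ht.trans htτ)
  have hD := norm_sub_le_of_eq_primitive (measurable_exp p.measurable_ψ)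
    (fun _ => (norm_exp_heading _).le) p.motion_D ht (ht.trans htτ)
  rw [abs_of_nonneg (sub_nonneg.2 htτ)] at hA hD
  have e : (p.state t).A - (p.state t).D =
      ((p.state τ).D - (p.state t).D) - ((p.state τ).A - (p.state t).A) := by rw [h]; ring
  rw [e]
  linarith [norm_sub_le ((p.state τ).D - (p.state t).D) ((p.state τ).A - (p.state t).A)]

/-- If the attacker uses his law and the defender meets him non-tangentially, then the time to go
cannot stay bounded away from `0`: the closing speed would come from a defender who does not run
to the aimpoint, and the loss of value caused by this, of order `1 / |AD|`, is not integrable. -/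
theorem not_forall_le_time_to_go (hα0 : 0 ≤ α) (hα1 : α < 1) {t₀ τ b κ : ℝ} (ht₀ : t₀ ∈ Ico 0 τ)
    (h : ∀ t ∈ Ico 0 τ, p.state t ∈ escapeRegion α) (hp : p.AttackerFollows τ)
    (hmeet : (p.state τ).A = (p.state τ).D) (hκ : 0 < κ)
    (hnt : ∀ t ∈ Icc 0 τ, κ * (τ - t) ≤ ‖(p.state t).A - (p.state t).D‖) (hb : 0 < b) :
    ¬ ∀ t ∈ Ico t₀ τ, ∀ m : Aim α (p.state t), b ≤ m.τ := by
  intro hbτ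
  have hM : 0 < (1 - α ^ 2) / 2 := by nlinarith
  set B := (1 - α ^ 2) / 2 * b * κ with hB
  set K := (1 - α ^ 2) / 2 * (1 + κ) / 2 with hK
  have hB0 : 0 < B := by positivity
  have hK0 : 0 < K := by positivity
  -- a function that is bounded above, although its logarithmic terms tend to infinity
  set F : ℝ → ℝ := fun t => value α (p.state t) -
    B * (Real.log ‖(p.state t).A - (p.state t).D‖ - 1 / 2 * Real.log (τ - t)) - K * t with hF
  have hmono : ∀ t ∈ Ico t₀ τ, F t ≤ F t₀ := by
    intro t ht
    have hIcc : ∀ r ∈ Icc t₀ t, r ∈ Ico t₀ τ := fun r hr => ⟨hr.1, hr.2.trans_lt ht.2⟩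
    have hIco : ∀ r ∈ Ico t₀ τ, r ∈ Ico 0 τ := fun r hr => ⟨ht₀.1.trans hr.1, hr.2⟩
    have hlog : ContDiffOn ℝ 1 Real.log (Ioi 0) :=
      Real.contDiffOn_log.mono fun x (hx : 0 < x) => hx.ne'
    have hac1 := p.absolutelyContinuous_value hα0 hα1 ht₀.1 ht.1
      fun r hr => (h r (hIco r (hIcc r hr))).1
    have hac2 := absolutelyContinuous_comp_of_pos
      (p.absolutelyContinuous_dist hα0 hα1 ht₀.1 ht.1)
      (fun r hr => norm_pos_iff.2 (sub_ne_zero.2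
        (h r (hIco r (hIcc r (uIcc_of_le ht.1 ▸ hr)))).1)) hlog
    have hsub : AbsolutelyContinuousOnInterval (fun r => τ - r) t₀ t :=
      ContDiffOn.absolutelyContinuousOnInterval (by fun_prop)
    have hac3 := absolutelyContinuous_comp_of_pos hsub
      (fun r hr => sub_pos.2 (hIcc r (uIcc_of_le ht.1 ▸ hr)).2) hlog
    have hac4 : AbsolutelyContinuousOnInterval (fun r => K * r) t₀ t :=
      ContDiffOn.absolutelyContinuousOnInterval (by fun_prop)
    have hac := (hac1.sub ((hac2.sub (hac3.const_mul (1 / 2))).const_mul B)).sub hac4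
    refine le_of_ae_deriv_nonpos (f := F) ht.1 hac ?_
    filter_upwards [p.ae_hasDerivAt_value hα0 hα1 (ht₀.1.trans ht.1)] with r h1 hr d hd
    have hr' := hIcc r (Ioo_subset_Icc_self hr)
    have hr0 := hIco r hr'
    have hs := h r hr0
    obtain ⟨m⟩ := exists_aim hα0 hα1 hs
    obtain ⟨hv, hdist⟩ := h1 ⟨ht₀.1.trans_lt hr.1, hr.2⟩ m
    rw [(m.attackerLaw_iff hα0 hα1 hs).1 (hp r hr0 hs)] at hv hdist
    have hrτ : 0 < τ - r := sub_pos.2 hr'.2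
    have hdpos : 0 < ‖(p.state r).A - (p.state r).D‖ := norm_pos_iff.2 (sub_ne_zero.2 hs.1)
    have hl1 := hdist.log hdpos.ne'
    have hl2 := ((hasDerivAt_id r).const_sub τ).log hrτ.ne'
    have hFd := (hv.fun_sub ((hl1.fun_sub (hl2.const_mul (1 / 2))).const_mul B)).fun_sub
      ((hasDerivAt_id r).const_mul K)
    rw [hd.unique hFd]
    have hrate := m.rate_attacker_le hα0 hα1 hb (hbτ r hr' m) hκ
      (norm_exp_heading (p.ψ r)) (norm_exp_heading (p.φ r))
    rw [← hB, ← hK] at hrate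
    have hnt' : κ / (2 * ‖(p.state r).A - (p.state r).D‖) ≤ 1 / 2 * (1 / (τ - r)) := by
      rw [mul_one_div, div_div, div_le_div_iff₀ (by positivity) (by positivity)]
      linarith [hnt r ⟨hr0.1, hr0.2.le⟩]
    have hBn := mul_le_mul_of_nonneg_left hnt' hB0.le
    simp only [id_eq, neg_div, mul_neg, mul_one]
    linarith
  -- times close to `τ` at which the bound fails
  set C := F t₀ + B * Real.log 2 + K * τ + 1 with hC
  set δ := min (τ - t₀) (Real.exp (-(2 * C / B))) with hδ
  have hδ0 : 0 < δ := lt_min (sub_pos.2 ht₀.2) (Real.exp_pos _)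
  have ht : τ - δ ∈ Ico t₀ τ := ⟨by linarith [min_le_left (τ - t₀) (Real.exp (-(2 * C / B)))],
    by linarith⟩
  have ht0 : τ - δ ∈ Ico 0 τ := ⟨ht₀.1.trans ht.1, ht.2⟩
  have h1 := hmono _ ht
  have hvpos := value_pos hα0 hα1 (h _ ht0)
  have hdpos : 0 < ‖(p.state (τ - δ)).A - (p.state (τ - δ)).D‖ :=
    norm_pos_iff.2 (sub_ne_zero.2 (h _ ht0).1)
  have h2 : Real.log ‖(p.state (τ - δ)).A - (p.state (τ - δ)).D‖ ≤ Real.log 2 + Real.log δ := by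
    rw [← Real.log_mul two_ne_zero hδ0.ne']
    refine Real.log_le_log hdpos ((p.dist_le_two_mul ht0.1 ht0.2.le hmeet).trans ?_)
    rw [sub_sub_cancel]
  have h3 : Real.log δ ≤ -(2 * C / B) := by
    rw [← Real.log_exp (-(2 * C / B))]
    exact Real.log_le_log hδ0 (min_le_right _ _)
  have h4 : B * Real.log δ ≤ -(2 * C) := by
    have := mul_le_mul_of_nonneg_left h3 hB0.le
    rwa [mul_neg, mul_div_cancel₀ _ hB0.ne'] at this
  have h5 := mul_le_mul_of_nonneg_left h2 hB0.le
  have h6 : K * (τ - δ) ≤ K * τ := by gcongr; linarith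
  simp only [hF, sub_sub_cancel] at h1
  simp only [hF] at hC
  linarith

theorem norm_sub_le_value_of_attackerFollows (hα0 : 0 ≤ α) (hα1 : α < 1) {a τ : ℝ}
    (ha : a ∈ Ico 0 τ) (h : ∀ t ∈ Ico 0 τ, p.state t ∈ escapeRegion α)
    (hp : p.AttackerFollows τ) (hmeet : (p.state τ).A = (p.state τ).D)
    (hnt : p.NonTangential τ) :
    ‖(p.state τ).A - (p.state τ).T‖ ≤ value α (p.state a) := by
  by_contra! hlt
  obtain ⟨κ, hκ, hnt⟩ := hnt
  set R := ‖(p.state τ).A - (p.state τ).T‖ with hR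
  set b := (R - value α (p.state a)) / 4 with hb
  have hb0 : 0 < b := by rw [hb]; linarith
  have hcont := p.continuousOn_norm_sub hα0 hα1 ha.1 ha.2.le
  have hev : ∀ᶠ t in nhdsWithin τ (Icc a τ), R - 2 * b < ‖(p.state t).A - (p.state t).T‖ :=
    (hcont τ (right_mem_Icc.2 ha.2.le)).eventually (Ioi_mem_nhds (by linarith))
  obtain ⟨ε, hε, hball⟩ := Metric.mem_nhdsWithin_iff.1 hev
  have ht₀ : max a (τ - ε / 2) < τ := max_lt ha.2 (by linarith)
  refine p.not_forall_le_time_to_go hα0 hα1 (t₀ := max a (τ - ε / 2))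
    ⟨ha.1.trans (le_max_left _ _), ht₀⟩ h hp hmeet hκ hnt hb0 fun t ht m => ?_
  have hat : a ≤ t := (le_max_left _ _).trans ht.1
  have h1 : R - 2 * b < ‖(p.state t).A - (p.state t).T‖ := by
    refine hball ⟨?_, hat, ht.2.le⟩
    rw [Metric.mem_ball, Real.dist_eq, abs_sub_comm, abs_of_nonneg (by linarith [ht.2])]
    linarith [(le_max_right _ _).trans ht.1]
  have h2 := m.norm_sub_target_le hα0 hα1
  have h3 := p.value_le_of_attackerFollows hα0 hα1 ha.1 hat ht.2 h hp
  linarith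

theorem attacker_guarantee (hα0 : 0 ≤ α) (hα1 : α < 1) {τ : ℝ} (hτ : 0 < τ)
    (h : ∀ t ∈ Ico 0 τ, p.state t ∈ escapeRegion α) (hp : p.AttackerFollows τ)
    (hmeet : (p.state τ).A = (p.state τ).D) (hnt : p.NonTangential τ)
    (heq : ‖(p.state τ).A - (p.state τ).T‖ = value α (p.state 0)) :
    ∀ᵐ t ∂(volume.restrict (Ico 0 τ)), DefenderLaw α (p.state t) (p.ψ t) ∧
      (0 < α → TargetLaw α (p.state t) (p.φ t)) := by
  have hconst : ∀ t ∈ Ico 0 τ, value α (p.state t) = value α (p.state 0) := fun t ht =>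
    le_antisymm (p.value_le_of_attackerFollows hα0 hα1 le_rfl ht.1 ht.2 h hp)
      (heq ▸ p.norm_sub_le_value_of_attackerFollows hα0 hα1 ht h hp hmeet hnt)
  filter_upwards [p.ae_rate_eq_zero hα0 hα1 hτ hconst] with t ⟨ht, h'⟩
  have hs := h t ht
  obtain ⟨m⟩ := exists_aim hα0 hα1 hs
  have h' := h' m
  rw [(m.attackerLaw_iff hα0 hα1 hs).1 (hp t ht hs)] at h'
  obtain ⟨hD, hT⟩ := m.eq_dir_of_rate_eq_zero hα0 hα1 (norm_exp_heading _) (norm_exp_heading _) h'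
  exact ⟨(m.defenderLaw_iff hα0 hα1 hs).2 hD,
    fun hα => (m.targetLaw_iff hα0 hα1 hs).2 (hT hα)⟩

end Play

end ATDDG

end

theorem mainTheorem3 (α : ℝ) (hα0 : 0 ≤ α) (hα1 : α < 1) :
    -- the roots `y₁ ≤ yT ≤ y₂` of the quartic, and their uniqueness
    (∀ xA xT yT : ℝ, 0 < xA → 0 ≤ yT →
      (∃! y₁, ATDDG.IsY1 α xA xT yT y₁) ∧ (∃ y₂, ATDDG.IsY2 α xA xT yT y₂) ∧
      (0 < yT ∨ (0 < xT ∧ ATDDG.CanEscape α xA xT yT) →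
        ∃! y₂, ATDDG.IsY2 α xA xT yT y₂)) ∧
    -- the feedback laws form a saddle point with value `V`
    ∃ V : ATDDG.GameState → ℝ, ∀ s ∈ ATDDG.escapeRegion α,
      -- when both teams use the laws, the attacker is intercepted at cost `V s`
      (∃ (p : ATDDG.Play α) (τ : ℝ), p.state 0 = s ∧ 0 < τ ∧ p.Running τ ∧
        (∀ t ∈ Set.Ico 0 τ, p.state t ∈ ATDDG.escapeRegion α) ∧
        p.AttackerFollows τ ∧ p.TeamFollows τ ∧
        (p.state τ).A = (p.state τ).D ∧ p.NonTangential τ ∧ p.cost τ = V s) ∧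
      -- what target and defender guarantee against every behaviour of the attacker
      (∀ (p : ATDDG.Play α) (τ : ℝ), p.state 0 = s → 0 < τ →
        (∀ t ∈ Set.Ico 0 τ, (p.state t).A ≠ (p.state t).D) → p.TeamFollows τ →
        p.Running τ ∧
        (∀ t ∈ Set.Ico 0 τ, p.state t ∈ ATDDG.escapeRegion α ∧ V s ≤ V (p.state t)) ∧
        ((p.state τ).A = (p.state τ).D →
          V s ≤ p.cost τ ∧
          (p.cost τ = V s → ∀ᵐ t ∂(MeasureTheory.volume.restrict (Set.Ico 0 τ)),
            ATDDG.AttackerLaw α (p.state t) (p.χ t)))) ∧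
      -- what the attacker guarantees against every behaviour of target and defender
      (∀ (p : ATDDG.Play α) (τ : ℝ), p.state 0 = s → 0 < τ →
        (∀ t ∈ Set.Ico 0 τ, p.state t ∈ ATDDG.escapeRegion α) → p.AttackerFollows τ →
        (∀ t ∈ Set.Ico 0 τ, V (p.state t) ≤ V s) ∧
        ((p.state τ).A = (p.state τ).D → p.NonTangential τ →
          p.cost τ ≤ V s ∧
          (p.cost τ = V s → ∀ᵐ t ∂(MeasureTheory.volume.restrict (Set.Ico 0 τ)),
            ATDDG.DefenderLaw α (p.state t) (p.ψ t) ∧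
            (0 < α → ATDDG.TargetLaw α (p.state t) (p.φ t))))) := by
  refine ⟨fun xA xT yT hA hT => ⟨?_, ATDDG.exists_isY2 hα0 hα1, fun hE => ?_⟩,
    fun s => ATDDG.value α s ^ 2 / 2, fun s hs => ⟨?_, ?_, ?_⟩⟩
  · obtain ⟨y, hy⟩ := ATDDG.exists_isY1 (α := α) (xA := xA) (xT := xT) hT
    exact ⟨y, hy, fun y' hy' => hy'.unique hα0 hα1 hA hy⟩
  · obtain ⟨y, hy⟩ := ATDDG.exists_isY2 (xA := xA) (xT := xT) (yT := yT) hα0 hα1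
    exact ⟨y, hy, fun y' hy' => hy'.unique hα0 hα1 hA hT hE hy⟩
  · obtain ⟨m⟩ := ATDDG.exists_aim hα0 hα1 hs
    exact m.exists_optimal_play hα0 hα1
  · rintro p τ rfl hτ hne hp
    have hmem := fun t ht => p.mem_escapeRegion_of_teamFollows hα0 hα1 hs hne hp (t := t) ht
    have hv := ATDDG.value_pos hα0 hα1 hs
    obtain ⟨hcost, hlaw⟩ := p.team_guarantee hα0 hα1 hτ hs hne hp
    refine ⟨fun t ht => ⟨hne t ht, ?_⟩, fun t ht => ⟨(hmem t ht).1, ?_⟩, fun _ => ⟨?_, fun h => ?_⟩⟩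
    · have h := ATDDG.value_le_norm_sub hα0 hα1 (hne t ht)
      exact sub_ne_zero.1 (norm_pos_iff.1 ((ATDDG.value_pos hα0 hα1 (hmem t ht).1).trans_le h))
    · have := (hmem t ht).2
      beta_reduce
      gcongr
    · unfold ATDDG.Play.cost
      beta_reduce
      gcongr
    · refine hlaw ?_
      unfold ATDDG.Play.cost at h
      rw [← sq_eq_sq₀ (norm_nonneg _) hv.le]
      linarith
  · rintro p τ rfl hτ hmem hp
    have hv := ATDDG.value_pos hα0 hα1 hs
    refine ⟨fun t ht => ?_, fun hmeet hnt => ⟨?_, fun h => ?_⟩⟩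
    · have := p.value_le_of_attackerFollows hα0 hα1 le_rfl ht.1 ht.2 hmem hp
      have := ATDDG.value_pos hα0 hα1 (hmem t ht)
      beta_reduce
      gcongr
    · have := p.norm_sub_le_value_of_attackerFollows hα0 hα1 ⟨le_rfl, hτ⟩ hmem hp hmeet hnt
      unfold ATDDG.Play.cost
      beta_reduce
      gcongr
    · refine p.attacker_guarantee hα0 hα1 hτ hmem hp hmeet hnt ?_
      unfold ATDDG.Play.cost at h
      rw [← sq_eq_sq₀ (norm_nonneg _) hv.le]
      linarith
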